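/- Let $p\ge 4$ be even. For a tensor $A\in(\mathbb R^N)^{\otimes p}$ and $u\in\mathbb R^N$ put $A(u)=\sum_{i_1,\dots,i_p}A_{i_1,\dots,i_p}u_{i_1}\cdots u_{i_p}$, and let $A(\cdot,u)\in\mathbb R^N$ have coordinates $\sum_{i_2,\dots,i_p}A_{i,i_2,\dots,i_p}u_{i_2}\cdots u_{i_p}$. Let $\mathcal B_N=\{-1,1\}^N$, $\mathcal H_N=[-1,1]^N$ and $\eta_N(A)=\frac1N\min_{\sigma\in\mathcal B_N}A(\sigma)$. Let $A,\hat A$ be independent tensors with i.i.d. $\mathcal N(0,N^{-(p-1)})$ entries, and $A_\tau=\sqrt{1-\tau}\,A+\sqrt\tau\,\hat A$ for $\tau\in[0,1]$. Write $\mathbb E\,\eta_N$ for $\mathbb E\,\eta_N(A)$. **Conjecture (for $p$).** (i) There are $\mu>0$, $0<\nu_1<\nu_2<1$ and $c>0$ such that for all large $N$, with probability at least $1-e^{-cN}$: for all $\tau_1,\tau_2\in[0,1]$ and all $u_1,u_2\in\mathcal H_N$ with $\frac1N A_{\tau_j}(u_j)\le\frac1N\inf_{w\in\mathcal H_N}A_{\tau_j}(w)+\mu$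 ($j=1,2$) one has $\frac{|\langle u_1,u_2\rangle|}{\|u_1\|_2\|u_2\|_2}\in[0,\nu_1]\cup[\nu_2,1]$ (the quotient being read as $0$ if some $u_j=0$). (ii) For every $\varepsilon>0$ there are $\delta>0$ and $c>0$ such that for all large $N$, with probability at least $1-e^{-cN}$: all $v_1,v_2\in\mathcal H_N$ with $\frac1N A(v_1)\le(1-\delta)\,\mathbb E\,\eta_N$ and $\frac1N\hat A(v_2)\le(1-\delta)\,\mathbb E\,\eta_N$ satisfy $|\langle v_1,v_2\rangle|\le\varepsilon N$. **TAP free energy.** Let $S(x)=\frac12(1+x)\log(1+x)+\frac12(1-x)\log(1-x)$ and $f_\beta(x)=\frac{\beta^2}2\bigl(1-x^p-p\,x^{p-1}(1-x)\bigr)$. For weights $s,\kappa\ge0$ (normalisations of the entropy and of the correction term) let $$F_\beta(x)=F_\beta^{s,\kappa}(x)=\beta A(x)-s\sum_{i=1}^N S(x_i)+\kappa f_\beta\bigl(\|x\|_2^2/N\bigr),\qquad x\in\mathcal H_N;$$ $s=\kappa=1$ is $\beta A-S+f_\beta(\|x\|^2/N)$, while $s=1,\ \kappa=N$ is the normalisation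 in which all terms are of order $N$. **TAP-type iteration.** For $M>0$ let $[x]_M=\max(-M,\min(x,M))$, coordinatewise. For $q>0$ and a bounded real sequence $(a_t)_{t\ge 0}$ let $U^{-1}=0$, $U^0=q\,1_N$ and $$U^t=\bigl[\tanh\bigl(\beta A(\cdot,U^{t-1})+a_{t-2}U^{t-2}\bigr)\bigr]_M,\qquad 1\le t\le T,$$ with $\tanh$ applied coordinatewise (for $t=1$ the second term is $0$), and let $V=[U^T]_1\in\mathcal H_N$. **Corollary.** Let $p\ge4$ be even and assume the Conjecture for $p$. Then there are $\bar\mu>0$ and $\beta_0>0$ such that for all $M>0$, all integers $T\ge1$, all $\beta\ge\beta_0$, all $q>0$ and all bounded sequences $(a_t)$ there is $c>0$ such that for all sufficiently large $N$ and all weights $s,\kappa\ge0$, $$\mathbb P\left(\frac{F_\beta(V)}{\beta N}\ \ge\ \min_{x\in\mathcal H_N}\frac{F_\beta(x)}{\beta N}+\bar\mu\right)\ \ge\ 1-e^{-cN}.$$ -/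

import Mathlib

open MeasureTheory ProbabilityTheory Filter
open scoped NNReal

namespace PSpin

noncomputable section

/-- Tensors of order `p` over `ℝ^N`, given by their entries `A_{i_1, …, i_p}`. -/
abbrev Tensor (p N : ℕ) : Type := (Fin p → Fin N) → ℝ

/-- `ℝ^N` with the Euclidean inner product and norm. -/
abbrev Vec (N : ℕ) : Type := EuclideanSpace ℝ (Fin N)

variable {p N : ℕ}

/-- The `p`-spin objective `A(u) = ∑ A_{i_1, …, i_p} u_{i_1} ⋯ u_{i_p}`. -/
def Tensor.form (A : Tensor p N) (u : Vec N) : ℝ :=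
  ∑ J : Fin p → Fin N, A J * ∏ k, u (J k)

/-- The vector `A(·, u)`: its coordinate `i` is
`∑ A_{i, i_2, …, i_p} u_{i_2} ⋯ u_{i_p}`, the first index being fixed to `i`. -/
def Tensor.marginal (A : Tensor p N) (u : Vec N) : Vec N :=
  WithLp.toLp 2 fun i =>
    ∑ J : Fin p → Fin N with ∀ k : Fin p, k.val = 0 → J k = i,
      A J * ∏ k : Fin p with k.val ≠ 0, u (J k)

/-- The binary cube `B_N = {-1, 1}^N`. -/
def binaryCube (N : ℕ) : Set (Vec N) := {σ | ∀ i, σ i = -1 ∨ σ i = 1}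

/-- The cube `H_N = [-1, 1]^N`. -/
def cube (N : ℕ) : Set (Vec N) := {x | ∀ i, x i ∈ Set.Icc (-1 : ℝ) 1}

/-- `η_N = (1/N) min_{σ ∈ B_N} A(σ)`. -/
def groundState (A : Tensor p N) : ℝ := sInf (A.form '' binaryCube N) / N

/-- The law of a tensor with i.i.d. `𝒩(0, N^{-(p-1)})` entries. -/
def gaussianTensor (p N : ℕ) : Measure (Tensor p N) :=
  Measure.pi fun _ => gaussianReal 0 ((N : ℝ≥0) ^ (p - 1))⁻¹

/-- The law of a pair `(A, Â)` of independent Gaussian tensors. -/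
def gaussianTensorPair (p N : ℕ) : Measure (Tensor p N × Tensor p N) :=
  (gaussianTensor p N).prod (gaussianTensor p N)

/-- The overlap gap property of a set `𝒜` of tensors, with domain `S` and parameters
`μ, ν₁, ν₂`. -/
def OverlapGapProperty (𝒜 : Set (Tensor p N)) (S : Set (Vec N)) (μ ν₁ ν₂ : ℝ) : Prop :=
  ∀ A₁ ∈ 𝒜, ∀ A₂ ∈ 𝒜, ∀ u₁ ∈ S, ∀ u₂ ∈ S,
    A₁.form u₁ / N ≤ sInf (A₁.form '' S) / N + μ →
    A₂.form u₂ / N ≤ sInf (A₂.form '' S) / N + μ →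
    |inner ℝ u₁ u₂| / (‖u₁‖ * ‖u₂‖) ∈ Set.Icc 0 ν₁ ∪ Set.Icc ν₂ 1

/-- The family `A_τ = √(1-τ) A + √τ Â`, `0 ≤ τ ≤ 1`. -/
def interpolation (A A' : Tensor p N) : Set (Tensor p N) :=
  (fun τ : ℝ => √(1 - τ) • A + √τ • A') '' Set.Icc 0 1

/-- The conjecture for tensors of order `p`. Both assertions hold outside an event of
exponentially small probability:
* the interpolated family satisfies the overlap gap property on `H_N`;
* near ground states of two independent tensors are nearly orthogonal: for every `ε > 0` there is
  a level `δ > 0` at which all their overlaps are at most `ε N`. -/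
def OGPConjecture (p : ℕ) : Prop :=
  (∃ μ ν₁ ν₂ : ℝ, 0 < μ ∧ 0 < ν₁ ∧ ν₁ < ν₂ ∧ ν₂ < 1 ∧
    ∃ c : ℝ, 0 < c ∧ ∀ᶠ N : ℕ in atTop,
      (gaussianTensorPair p N).real
        {AA | ¬ OverlapGapProperty (interpolation AA.1 AA.2) (cube N) μ ν₁ ν₂}
          ≤ Real.exp (-c * N)) ∧
  (∀ ε : ℝ, 0 < ε → ∃ δ : ℝ, 0 < δ ∧
    ∃ c : ℝ, 0 < c ∧ ∀ᶠ N : ℕ in atTop,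
      (gaussianTensorPair p N).real
        {AA | ¬ ∀ v₁ ∈ cube N, ∀ v₂ ∈ cube N,
          AA.1.form v₁ / N ≤ (1 - δ) * ∫ A, groundState A ∂(gaussianTensor p N) →
          AA.2.form v₂ / N ≤ (1 - δ) * ∫ A, groundState A ∂(gaussianTensor p N) →
          |inner ℝ v₁ v₂| ≤ ε * N}
          ≤ Real.exp (-c * N))

/-- The truncation `[x]_M = max(-M, min(x, M))`, coordinate by coordinate. -/
def trunc (M : ℝ) (x : Vec N) : Vec N := WithLp.toLp 2 fun i => max (-M) (min (x i) M)

/-- `tanh` applied coordinate by coordinate. -/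
def vecTanh (x : Vec N) : Vec N := WithLp.toLp 2 fun i => Real.tanh (x i)

/-- The iterates `U^t` of the truncated TAP-type iteration
`U^t = [tanh(β A(·, U^{t-1}) + a_{t-2} U^{t-2})]_M` with `U^0 = q 1_N` and `U^{-1} = 0`
(so that `U^1 = [tanh(β A(·, U^0))]_M`). -/
def tapIterate (A : Tensor p N) (β M q : ℝ) (a : ℕ → ℝ) : ℕ → Vec N
  | 0 => WithLp.toLp 2 fun _ => q
  | 1 => trunc M (vecTanh (β • A.marginal (tapIterate A β M q a 0)))
  | t + 2 => trunc M (vecTanh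
      (β • A.marginal (tapIterate A β M q a (t + 1)) + a t • tapIterate A β M q a t))

/-- The output `V = [U^T]_1 ∈ H_N` after `T` iterations. -/
def tapOutput (A : Tensor p N) (β M q : ℝ) (a : ℕ → ℝ) (T : ℕ) : Vec N :=
  trunc 1 (tapIterate A β M q a T)

/-- The Bernoulli entropy `S` on `[-1, 1]`. -/
def bernoulliEntropy (x : ℝ) : ℝ :=
  1 / 2 * (1 + x) * Real.log (1 + x) + 1 / 2 * (1 - x) * Real.log (1 - x)

/-- `f_β(x) = (β²/2) (1 - x^p - p x^{p-1} (1 - x))`. -/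
def onsager (p : ℕ) (β x : ℝ) : ℝ :=
  β ^ 2 / 2 * (1 - x ^ p - p * x ^ (p - 1) * (1 - x))

/-- The TAP free energy `F_β(x) = β A(x) - s ∑ᵢ S(xᵢ) + κ f_β(‖x‖² / N)`. The weights `s, κ ≥ 0`
are the normalisations of the entropy and of the correction term: `s = κ = 1` is
`β A - S + f_β`; `s = 1, κ = N` is the extensive normalisation, in which all three terms are of
order `N`; `s = 1 / N` averages the entropy instead of summing it. -/
def tapFreeEnergy (β s κ : ℝ) (A : Tensor p N) (x : Vec N) : ℝ :=
  β * A.form x - s * ∑ i, bernoulliEntropy (x i) + κ * onsager p β (‖x‖ ^ 2 / N)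

end

end PSpin

/-! The output of the iteration is a Lipschitz function of the tensor in the injective norm, with a
constant independent of $N$ (`exists_norm_tapOutput_sub_le`), and such a stable algorithm cannot
cross an overlap gap. Call the output successful if its energy per site is within `μ'` of the ground
state. The claim reduces to showing that success is exponentially unlikely.

Take a stationary Ornstein–Uhlenbeck chain of tensors with correlation `ρ` close to 1, and apply the
iteration to every member. The chain is reversible, so repeated Cauchy–Schwarz shows that all
$2^m+1$ outputs succeed with probability at least the $2^{m+1}$-th power of the probability of a
single success (`pow_measure_le_measure_chain`). Since `m` does not depend on $N$, a success
probability that is not exponentially small would exceed the probability of all exceptional events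
together. No concentration of the algorithm itself is needed.

Outside the exceptional events, simultaneous success is contradictory (`false_of_chain_success`).
Every member of the chain belongs to the interpolation between the starting tensor and an
independent copy, so part (i) of the conjecture keeps the overlap of each output with the first one
out of $(\nu_1,\nu_2)$. The overlap starts at 1 and moves by less than $\nu_2-\nu_1$ per step, hence
stays above $\nu_2$. After $2^m$ steps the tensor is almost its independent part, and part (ii)
makes the last output nearly orthogonal to the first. The outputs have norm of order $\sqrt N$,
because the mean ground state energy is bounded away from 0 and the injective norm is bounded, so
the two statements clash.

The TAP free energy enters only at the end. On the cube it is at least $\beta A-sN\log 2$, with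
equality at the corners, for all weights. An energy gap above the corner ground state is therefore a
free energy gap of the same size (`sInf_tapFreeEnergy_add_le`). -/

namespace PSpin

/-! ### Linear functionals and rotations of i.i.d. Gaussian vectors. -/

section GaussianProduct

variable {ι : Type*} [Fintype ι]

/-- The law of a family of i.i.d. centred Gaussian variables of variance `v`. -/
noncomputable abbrev gaussianPi (ι : Type*) [Fintype ι] (v : ℝ≥0) : Measure (ι → ℝ) :=
  Measure.pi fun _ => gaussianReal 0 v

instance isGaussian_gaussianPi (v : ℝ≥0) : IsGaussian (gaussianPi ι v) := by
  have h : HasGaussianLaw (fun (ω : ι → ℝ) i => ω i) (gaussianPi ι v) := by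
    refine iIndepFun.hasGaussianLaw (X := fun i (ω : ι → ℝ) => ω i) (fun i => ?_) ?_
    · refine HasLaw.hasGaussianLaw (μ := gaussianReal 0 v)
        ⟨(measurable_pi_apply i).aemeasurable, ?_⟩
      exact (measurePreserving_eval (fun _ : ι => gaussianReal 0 v) i).map_eq
    · exact iIndepFun_pi (X := fun _ x => x) (fun i => by fun_prop)
  have := h.isGaussian_map
  simpa using this

lemma integral_id_gaussianPi (v : ℝ≥0) : (gaussianPi ι v)[id] = 0 := by
  ext i
  have hi : Integrable (fun x : ι → ℝ => x) (gaussianPi ι v) := IsGaussian.integrable_id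
  have := (ContinuousLinearMap.proj (R := ℝ) (φ := fun _ : ι => ℝ) i).integral_comp_comm hi
  simp only [ContinuousLinearMap.proj_apply] at this
  simp only [id, Pi.zero_apply]
  rw [← this]
  exact (integral_comp_eval (μ := fun _ : ι => gaussianReal 0 v) (i := i) (f := fun x : ℝ => x)
    (by fun_prop)).trans (by simp)

/-- A linear functional of i.i.d. centred Gaussian variables is Gaussian. -/
lemma map_sum_gaussianPi (v : ℝ≥0) (w : ι → ℝ) :
    (gaussianPi ι v).map (fun A => ∑ i, w i * A i) =
      gaussianReal 0 (v * (∑ i, w i ^ 2).toNNReal) := by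
  let L : (ι → ℝ) →L[ℝ] ℝ := ∑ i, w i • ContinuousLinearMap.proj i
  have hL : (fun A : ι → ℝ => ∑ i, w i * A i) = L := by
    ext A; simp [L]
  rw [hL, IsGaussian.map_eq_gaussianReal L]
  congr 1
  · have := L.integral_comp_comm (IsGaussian.integrable_id (μ := gaussianPi ι v))
    simp only [integral_id_gaussianPi, map_zero] at this
    simpa using this
  · rw [← hL]
    have := variance_sum_pi (μ := fun _ : ι => gaussianReal 0 v) (X := fun i x => w i * x)
      (fun i => (memLp_id_gaussianReal 2).const_mul (w i))
    have h2 : (∑ i, fun A : ι → ℝ => w i * A i) = fun A => ∑ i, w i * A i := by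
      ext; simp
    rw [h2] at this
    rw [this]
    have h3 : ∀ i, Var[fun x => w i * x; gaussianReal 0 v] = w i ^ 2 * v := fun i => by
      rw [variance_const_mul, variance_fun_id_gaussianReal]
    rw [Finset.sum_congr rfl fun i _ => h3 i, ← Finset.sum_mul]
    rw [mul_comm, Real.toNNReal_mul (by positivity), Real.toNNReal_coe]

lemma hasSubgaussianMGF_sum_gaussianPi (v : ℝ≥0) (w : ι → ℝ) :
    HasSubgaussianMGF (fun A => ∑ i, w i * A i) (v * (∑ i, w i ^ 2).toNNReal)
      (gaussianPi ι v) := by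
  have h := map_sum_gaussianPi v w
  rw [← HasSubgaussianMGF.id_map_iff (Measurable.aemeasurable (by fun_prop)), h]
  refine ⟨fun t => integrable_exp_mul_gaussianReal t, fun t => ?_⟩
  rw [mgf_id_gaussianReal]
  simp

/-- Tail bound for a linear functional of i.i.d. centred Gaussian variables. -/
lemma measure_abs_sum_ge_le (v : ℝ≥0) (w : ι → ℝ) {D t : ℝ} (ht : 0 ≤ t) (hD : 0 < D)
    (hw : v * ∑ i, w i ^ 2 ≤ D) :
    (gaussianPi ι v).real {A | t ≤ |∑ i, w i * A i|} ≤ 2 * Real.exp (-t ^ 2 / (2 * D)) := by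
  have key : ∀ w : ι → ℝ, v * ∑ i, w i ^ 2 ≤ D →
      (gaussianPi ι v).real {A | t ≤ ∑ i, w i * A i} ≤ Real.exp (-t ^ 2 / (2 * D)) := by
    intro w hw
    have h := hasSubgaussianMGF_sum_gaussianPi v w
    have h' : HasSubgaussianMGF (fun A => ∑ i, w i * A i) D.toNNReal (gaussianPi ι v) := by
      refine ⟨h.integrable_exp_mul, fun s => (h.mgf_le s).trans (Real.exp_le_exp.2 ?_)⟩
      have h0 : 0 ≤ ∑ i, w i ^ 2 := by positivity
      push_cast
      rw [Real.coe_toNNReal _ h0, Real.coe_toNNReal _ hD.le]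
      gcongr
    have := h'.measure_ge_le ht
    rwa [Real.coe_toNNReal _ hD.le] at this
  have h1 := key w hw
  have h2 := key (fun i => -w i) (by simpa using hw)
  calc _ ≤ (gaussianPi ι v).real ({A | t ≤ ∑ i, w i * A i} ∪ {A | t ≤ ∑ i, -w i * A i}) := by
        refine measureReal_mono (fun A hA => ?_) (by finiteness)
        rcases le_abs'.1 (Set.mem_ofPred.1 hA) with h | h
        · right; simp only [neg_mul, Finset.sum_neg_distrib, Set.mem_ofPred_eq]; linarith
        · left; exact h
    _ ≤ _ := (measureReal_union_le _ _).trans (by linarith)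

/-- The mean absolute value of a linear functional of i.i.d. centred Gaussian variables. -/
lemma integral_abs_sum_gaussianPi (v : ℝ≥0) (w : ι → ℝ) :
    ∫ A, |∑ i, w i * A i| ∂(gaussianPi ι v) =
      √(v * ∑ i, w i ^ 2) * ∫ x, |x| ∂(gaussianReal 0 1) := by
  have h0 : 0 ≤ ∑ i, w i ^ 2 := by positivity
  have h1 : ∫ A, |∑ i, w i * A i| ∂(gaussianPi ι v) =
      ∫ x, |x| ∂((gaussianPi ι v).map fun A => ∑ i, w i * A i) :=
    (integral_map (f := fun x : ℝ => |x|) (Measurable.aemeasurable (by fun_prop))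
      (by fun_prop)).symm
  have h2 : gaussianReal 0 (v * (∑ i, w i ^ 2).toNNReal) =
      (gaussianReal 0 1).map (fun x => √(v * ∑ i, w i ^ 2) * x) := by
    rw [gaussianReal_map_const_mul]
    congr 1
    · simp
    · ext
      push_cast
      rw [Real.coe_toNNReal _ h0, mul_one]
      exact (Real.sq_sqrt (by positivity)).symm
  rw [h1, map_sum_gaussianPi, h2, integral_map (by fun_prop) (by fun_prop)]
  simp_rw [abs_mul, abs_of_nonneg (Real.sqrt_nonneg _)]
  rw [integral_const_mul]

lemma integral_abs_gaussianReal_pos : 0 < ∫ x, |x| ∂(gaussianReal 0 1) := by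
  have hi : Integrable (fun x : ℝ => |x|) (gaussianReal 0 1) :=
    ((memLp_id_gaussianReal 1).integrable le_rfl).abs
  rw [integral_pos_iff_support_of_nonneg (fun x => abs_nonneg x) hi]
  have : Function.support (fun x : ℝ => |x|) = {0}ᶜ := by ext x; simp
  have := nullSingletonClass_gaussianReal (μ := 0) (v := 1) one_ne_zero
  rw [‹Function.support _ = _›, prob_compl_eq_one_sub (measurableSet_singleton 0)]
  simp

/-- The reflection invariance of a pair of independent centred Gaussian vectors. -/
lemma measurePreserving_reflection (v : ℝ≥0) {a b : ℝ} (hab : a ^ 2 + b ^ 2 = 1) :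
    MeasurePreserving (fun z : (ι → ℝ) × (ι → ℝ) => (a • z.1 + b • z.2, b • z.1 - a • z.2))
      ((gaussianPi ι v).prod (gaussianPi ι v)) ((gaussianPi ι v).prod (gaussianPi ι v)) := by
  obtain ⟨θ, rfl, rfl⟩ : ∃ θ, a = Real.cos θ ∧ b = Real.sin θ := by
    have : ‖(⟨a, b⟩ : ℂ)‖ = 1 := by
      rw [Complex.norm_def, Complex.normSq_mk, ← pow_two, ← pow_two, hab, Real.sqrt_one]
    refine ⟨Complex.arg ⟨a, b⟩, ?_, ?_⟩
    · rw [Complex.cos_arg (by intro h; simp [h] at this), this]; simp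
    · rw [Complex.sin_arg, this]; simp
  have hrot : MeasurePreserving (ContinuousLinearMap.rotation (E := ι → ℝ) θ)
      ((gaussianPi ι v).prod (gaussianPi ι v)) ((gaussianPi ι v).prod (gaussianPi ι v)) :=
    ⟨by fun_prop, IsGaussian.map_rotation_eq_self (integral_id_gaussianPi v) θ⟩
  have hneg1 : MeasurePreserving (fun x : ι → ℝ => fun i => -x i)
      (gaussianPi ι v) (gaussianPi ι v) := by
    refine measurePreserving_pi _ _ fun i => ⟨by fun_prop, ?_⟩
    rw [gaussianReal_map_neg, neg_zero]
  -- The reflection is the rotation by `θ` followed by a change of sign of the second component.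
  have hneg := (MeasurePreserving.id (gaussianPi ι v)).prod hneg1
  convert! hneg.comp hrot using 1
  ext z i <;> simp [ContinuousLinearMap.rotation_apply]
  ring

lemma measurePreserving_combination (v : ℝ≥0) {a b : ℝ} (hab : a ^ 2 + b ^ 2 = 1) :
    MeasurePreserving (fun z : (ι → ℝ) × (ι → ℝ) => a • z.1 + b • z.2)
      ((gaussianPi ι v).prod (gaussianPi ι v)) (gaussianPi ι v) :=
  measurePreserving_fst.comp (measurePreserving_reflection v hab)

end GaussianProduct

end PSpin

namespace PSpin

/-! ### Gaussian concentration by tensorised exponential moments. -/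

section Concentration

lemma continuous_of_abs_sub_le {h : ℝ → ℝ} {L : ℝ} (hL : ∀ x y, |h x - h y| ≤ L * |x - y|) :
    Continuous h := by
  have hL0 : 0 ≤ L := by simpa using (abs_nonneg _).trans (hL 1 0)
  refine (LipschitzWith.of_dist_le_mul (K := L.toNNReal) fun x y => ?_).continuous
  rw [Real.coe_toNNReal _ hL0]
  exact hL x y

lemma integrable_of_abs_sub_le (v : ℝ≥0) {h : ℝ → ℝ} {L : ℝ}
    (hL : ∀ x y, |h x - h y| ≤ L * |x - y|) : Integrable h (gaussianReal 0 v) := by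
  have hc := continuous_of_abs_sub_le hL
  have hi : Integrable (fun x : ℝ => |x|) (gaussianReal 0 v) :=
    ((memLp_id_gaussianReal 1).integrable le_rfl).abs
  refine ((integrable_const |h 0|).add (hi.const_mul L)).mono' (by fun_prop)
    (.of_forall fun x => ?_)
  have h1 := hL x 0
  rw [sub_zero] at h1
  have := abs_sub_abs_le_abs_sub (h x) (h 0)
  simp only [Real.norm_eq_abs, Pi.add_apply]
  linarith

lemma integrable_exp_lipschitz (v : ℝ≥0) {h : ℝ → ℝ} {L : ℝ}
    (hL : ∀ x y, |h x - h y| ≤ L * |x - y|) (s : ℝ) :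
    Integrable (fun x => Real.exp (s * h x)) (gaussianReal 0 v) := by
  have hL0 : 0 ≤ L := by simpa using (abs_nonneg _).trans (hL 1 0)
  have hc := continuous_of_abs_sub_le hL
  have hi : Integrable (fun x : ℝ => Real.exp (|s| * L * |x|)) (gaussianReal 0 v) :=
    integrable_exp_mul_abs (integrable_exp_mul_gaussianReal _) (integrable_exp_mul_gaussianReal _)
  refine (hi.const_mul (Real.exp (|s| * |h 0|))).mono' (by fun_prop) (.of_forall fun x => ?_)
  rw [Real.norm_eq_abs, Real.abs_exp, ← Real.exp_add, Real.exp_le_exp]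
  have h1 := hL x 0
  rw [sub_zero] at h1
  have h2 : |h x| ≤ |h 0| + L * |x| := by
    have := abs_sub_abs_le_abs_sub (h x) (h 0)
    linarith
  calc s * h x ≤ |s * h x| := le_abs_self _
    _ = |s| * |h x| := abs_mul _ _
    _ ≤ |s| * (|h 0| + L * |x|) := by gcongr
    _ = _ := by ring

/-- Exponential moments of a centred Lipschitz function of a Gaussian variable. -/
lemma lintegral_exp_lipschitz_le (v : ℝ≥0) {h : ℝ → ℝ} {L : ℝ}
    (hL : ∀ x y, |h x - h y| ≤ L * |x - y|) (s : ℝ) :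
    ∫⁻ x, ENNReal.ofReal (Real.exp (s * (h x - ∫ y, h y ∂(gaussianReal 0 v))))
      ∂(gaussianReal 0 v) ≤ ENNReal.ofReal (Real.exp (s ^ 2 * L ^ 2 * v)) := by
  set ν := gaussianReal 0 v
  set m := ∫ y, h y ∂ν with hm
  have hL0 : 0 ≤ L := by simpa using (abs_nonneg _).trans (hL 1 0)
  have hc := continuous_of_abs_sub_le hL
  have hexp := integrable_exp_lipschitz v hL
  have hint : Integrable h ν := integrable_of_abs_sub_le v hL
  -- Jensen's inequality replaces the mean by an independent copy. The constant lost against the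
  -- optimal $s^2L^2v/2$ is irrelevant here.
  have hJ : Real.exp (-s * m) ≤ ∫ y, Real.exp (-s * h y) ∂ν := by
    have := convexOn_exp.map_integral_le (μ := ν) (f := fun y => -s * h y)
      Real.continuous_exp.continuousOn isClosed_univ (.of_forall fun _ => Set.mem_univ _)
      (hint.const_mul _) (hexp (-s))
    rwa [integral_const_mul] at this
  have hsq : (∫ x, Real.exp (s * h x) ∂ν) * ∫ y, Real.exp (-s * h y) ∂ν ≤
      Real.exp (s ^ 2 * L ^ 2 * v) := by
    have hp : ∀ (f : ℝ → ℝ), (∀ r : ℝ, Integrable (fun x => Real.exp (r * f x)) ν) → ∀ r : ℝ,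
        Integrable (fun z : ℝ × ℝ => Real.exp (r * f z.1) * Real.exp (-r * f z.2)) (ν.prod ν) :=
      fun f hf r => (hf r).mul_prod (hf (-r))
    have e1 := integral_prod_mul (μ := ν) (ν := ν) (fun x => Real.exp (s * h x))
      (fun y => Real.exp (-s * h y))
    have e2 := integral_prod_mul (μ := ν) (ν := ν) (fun x => Real.exp (-s * h x))
      (fun y => Real.exp (-(-s) * h y))
    have e3 := integral_prod_mul (μ := ν) (ν := ν) (fun x => Real.exp (s * L * x))
      (fun y => Real.exp (-(s * L) * y))
    have e4 := integral_prod_mul (μ := ν) (ν := ν) (fun x => Real.exp (-(s * L) * x))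
      (fun y => Real.exp (-(-(s * L)) * y))
    have hmgf : ∀ r : ℝ, ∫ x, Real.exp (r * x) ∂ν = Real.exp (v * r ^ 2 / 2) := fun r => by
      have := congrFun (mgf_fun_id_gaussianReal (μ := 0) (v := v)) r
      simpa [mgf] using this
    have hg : ∀ r : ℝ, Integrable (fun x : ℝ => Real.exp (r * x)) ν :=
      fun r => integrable_exp_mul_gaussianReal r
    have hle : ∫ z, (Real.exp (s * h z.1) * Real.exp (-s * h z.2) +
          Real.exp (-s * h z.1) * Real.exp (-(-s) * h z.2)) ∂(ν.prod ν) ≤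
        ∫ z : ℝ × ℝ, (Real.exp (s * L * z.1) * Real.exp (-(s * L) * z.2) +
          Real.exp (-(s * L) * z.1) * Real.exp (-(-(s * L)) * z.2)) ∂(ν.prod ν) := by
      -- Adding the terms for `s` and `-s` gives a hyperbolic cosine, which is monotone in the
      -- absolute value of its argument. The Lipschitz bound can thus be applied pointwise, and the
      -- right side is an explicit Gaussian integral.
      refine integral_mono ((hp h hexp s).add (hp h hexp (-s)))
        ((hp id hg (s * L)).add (hp id hg (-(s * L)))) fun z => ?_
      simp only [← Real.exp_add]
      have c1 : ∀ a b c d : ℝ, c = -b → d = -a → ∀ a' b' c' d' : ℝ, c' = -b' → d' = -a' →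
          |a + b| ≤ |a' + b'| → Real.exp (a + b) + Real.exp (d + c) ≤
            Real.exp (a' + b') + Real.exp (d' + c') := by
        rintro a b _ _ rfl rfl a' b' _ _ rfl rfl hab
        have := Real.cosh_le_cosh.2 hab
        rw [Real.cosh_eq, Real.cosh_eq] at this
        have e1 : -a + -b = -(a + b) := by ring
        have e2 : -a' + -b' = -(a' + b') := by ring
        rw [e1, e2]; linarith
      refine c1 _ _ _ _ (by ring) (by ring) _ _ _ _ (by ring) (by ring) ?_
      have : s * h z.1 + -s * h z.2 = s * (h z.1 - h z.2) := by ring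
      rw [this, abs_mul]
      have : s * L * z.1 + -(s * L) * z.2 = s * (L * (z.1 - z.2)) := by ring
      rw [this, abs_mul, abs_mul, abs_of_nonneg hL0]
      gcongr
      exact hL _ _
    have a2 := integral_add (hp id hg (s * L)) (hp id hg (-(s * L)))
    simp only [id] at a2
    rw [integral_add (hp h hexp s) (hp h hexp (-s)), a2, e1, e2, e3, e4] at hle
    simp only [hmgf, neg_neg] at hle
    simp only [← Real.exp_add] at hle
    have : (v : ℝ) * (s * L) ^ 2 / 2 + v * (-(s * L)) ^ 2 / 2 = s ^ 2 * L ^ 2 * v := by ring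
    rw [this] at hle
    have : (v : ℝ) * (-(s * L)) ^ 2 / 2 + v * (s * L) ^ 2 / 2 = s ^ 2 * L ^ 2 * v := by ring
    rw [this] at hle
    linarith
  have heq : ∀ x, Real.exp (s * (h x - m)) = Real.exp (-s * m) * Real.exp (s * h x) := fun x => by
    rw [← Real.exp_add]; congr 1; ring
  simp_rw [heq]
  rw [← ofReal_integral_eq_lintegral_ofReal ((hexp s).const_mul _)
    (.of_forall fun x => by positivity)]
  refine ENNReal.ofReal_le_ofReal ?_
  rw [integral_const_mul]
  refine le_trans ?_ hsq
  rw [mul_comm]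
  gcongr

variable {ι : Type*} [Fintype ι]

lemma continuous_of_abs_sub_le_sum {F : (ι → ℝ) → ℝ} {L : ℝ}
    (hF : ∀ x y, |F x - F y| ≤ L * ∑ i, |x i - y i|) : Continuous F := by
  rw [continuous_iff_continuousAt]
  intro y
  rw [ContinuousAt, tendsto_iff_norm_sub_tendsto_zero]
  refine squeeze_zero (fun _ => norm_nonneg _) (fun x => hF x y) ?_
  have : Continuous fun x : ι → ℝ => L * ∑ i, |x i - y i| := by fun_prop
  simpa using this.tendsto y

lemma integrable_of_abs_sub_le_sum (v : ℝ≥0) {F : (ι → ℝ) → ℝ} {L : ℝ}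
    (hF : ∀ x y, |F x - F y| ≤ L * ∑ i, |x i - y i|) : Integrable F (gaussianPi ι v) := by
  have hc := continuous_of_abs_sub_le_sum hF
  have hi : ∀ i, Integrable (fun x : ι → ℝ => |x i|) (gaussianPi ι v) := fun i =>
    (integrable_comp_eval (μ := fun _ : ι => gaussianReal 0 v) (i := i) (f := fun x : ℝ => x)
      ((memLp_id_gaussianReal 1).integrable le_rfl)).abs
  refine ((integrable_const |F 0|).add
    ((integrable_finsetSum Finset.univ fun i _ => hi i).const_mul L)).mono' (by fun_prop)
    (.of_forall fun x => ?_)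
  have h1 := hF x 0
  have := abs_sub_abs_le_abs_sub (F x) (F 0)
  simp only [Pi.zero_apply, sub_zero] at h1
  simp only [Real.norm_eq_abs, Pi.add_apply]
  linarith

/-- Averaging over one coordinate preserves the Lipschitz bound in the others. Splitting `F` minus
its mean into the fluctuation in the first coordinate and the centred average `G` therefore adds one
factor $e^{s^2L^2v}$ per coordinate. -/
lemma lintegral_exp_le_fin (v : ℝ≥0) {L : ℝ} (s : ℝ) (n : ℕ) (F : (Fin n → ℝ) → ℝ)
    (hF : ∀ x y, |F x - F y| ≤ L * ∑ i, |x i - y i|) :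
    ∫⁻ x, ENNReal.ofReal (Real.exp (s * (F x - ∫ y, F y ∂(gaussianPi (Fin n) v))))
      ∂(gaussianPi (Fin n) v) ≤ ENNReal.ofReal (Real.exp (s ^ 2 * L ^ 2 * v * n)) := by
  induction n with
  | zero =>
    have : ∀ x, F x = F 0 := fun x => congrArg F (Subsingleton.elim _ _)
    simp [this]
  | succ n ih =>
    set ν := gaussianReal 0 v
    let e := MeasurableEquiv.piFinSuccAbove (fun _ : Fin (n + 1) => ℝ) 0
    have he : MeasurePreserving e.symm (ν.prod (gaussianPi (Fin n) v))
        (gaussianPi (Fin (n + 1)) v) :=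
      (measurePreserving_piFinSuccAbove (fun _ : Fin (n + 1) => ν) 0).symm
    have hsum : ∀ z z' : ℝ × (Fin n → ℝ), ∑ i, |e.symm z i - e.symm z' i| =
        |z.1 - z'.1| + ∑ i, |z.2 i - z'.2 i| := fun z z' => by
      rw [Fin.sum_univ_succ]
      simp [e, MeasurableEquiv.piFinSuccAbove, Fin.insertNthEquiv]
    have hFz : ∀ z z', |F (e.symm z) - F (e.symm z')| ≤
        L * (|z.1 - z'.1| + ∑ i, |z.2 i - z'.2 i|) := fun z z' => by
      rw [← hsum]; exact hF _ _
    have hFc := continuous_of_abs_sub_le_sum hF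
    have hFi := integrable_of_abs_sub_le_sum v hF
    have hFm : Measurable fun z => F (e.symm z) := hFc.measurable.comp e.symm.measurable
    have hFe : Integrable (fun z => F (e.symm z)) (ν.prod (gaussianPi (Fin n) v)) :=
      he.integrable_comp_of_integrable hFi
    have hx : ∀ y x x', |F (e.symm (x, y)) - F (e.symm (x', y))| ≤ L * |x - x'| :=
      fun y x x' => by simpa using hFz (x, y) (x', y)
    have hxi : ∀ y, Integrable (fun x => F (e.symm (x, y))) ν :=
      fun y => integrable_of_abs_sub_le v (hx y)
    let G : (Fin n → ℝ) → ℝ := fun y => ∫ x, F (e.symm (x, y)) ∂ν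
    have hG : ∀ y y', |G y - G y'| ≤ L * ∑ i, |y i - y' i| := fun y y' => by
      simp only [G]
      rw [← integral_sub (hxi y) (hxi y')]
      have := norm_integral_le_of_norm_le_const (μ := ν)
        (f := fun x => F (e.symm (x, y)) - F (e.symm (x, y'))) (C := L * ∑ i, |y i - y' i|)
        (.of_forall fun x => by simpa using hFz (x, y) (x, y'))
      simpa using this
    have hGm : Measurable G := (continuous_of_abs_sub_le_sum hG).measurable
    have hmean : ∫ y, F y ∂(gaussianPi (Fin (n + 1)) v) = ∫ y, G y ∂(gaussianPi (Fin n) v) := by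
      rw [← he.integral_comp' (f := e.symm) F, integral_prod_symm _ hFe]
    rw [hmean, ← he.lintegral_comp (by fun_prop)]
    set m := ∫ y, G y ∂(gaussianPi (Fin n) v)
    rw [lintegral_prod_symm _ (Measurable.aemeasurable (by fun_prop))]
    calc ∫⁻ y, ∫⁻ x, ENNReal.ofReal (Real.exp (s * (F (e.symm (x, y)) - m))) ∂ν
          ∂(gaussianPi (Fin n) v)
        = ∫⁻ y, ENNReal.ofReal (Real.exp (s * (G y - m))) *
            ∫⁻ x, ENNReal.ofReal (Real.exp (s * (F (e.symm (x, y)) - G y))) ∂ν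
            ∂(gaussianPi (Fin n) v) := by
          refine lintegral_congr fun y => ?_
          rw [← lintegral_const_mul _ (by fun_prop)]
          refine lintegral_congr fun x => ?_
          rw [← ENNReal.ofReal_mul (by positivity), ← Real.exp_add]
          congr 2; ring
      _ ≤ ∫⁻ y, ENNReal.ofReal (Real.exp (s * (G y - m))) *
            ENNReal.ofReal (Real.exp (s ^ 2 * L ^ 2 * v)) ∂(gaussianPi (Fin n) v) := by
          refine lintegral_mono fun y => ?_
          gcongr
          exact lintegral_exp_lipschitz_le v (hx y) s
      _ = (∫⁻ y, ENNReal.ofReal (Real.exp (s * (G y - m))) ∂(gaussianPi (Fin n) v)) *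
            ENNReal.ofReal (Real.exp (s ^ 2 * L ^ 2 * v)) :=
          lintegral_mul_const _ (by fun_prop)
      _ ≤ ENNReal.ofReal (Real.exp (s ^ 2 * L ^ 2 * v * n)) *
            ENNReal.ofReal (Real.exp (s ^ 2 * L ^ 2 * v)) := by
          gcongr
          exact ih G hG
      _ = _ := by
          rw [← ENNReal.ofReal_mul (by positivity), ← Real.exp_add]
          congr 2; push_cast; ring

lemma lintegral_exp_le (v : ℝ≥0) {L : ℝ} (s : ℝ) (F : (ι → ℝ) → ℝ)
    (hF : ∀ x y, |F x - F y| ≤ L * ∑ i, |x i - y i|) :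
    ∫⁻ x, ENNReal.ofReal (Real.exp (s * (F x - ∫ y, F y ∂(gaussianPi ι v))))
      ∂(gaussianPi ι v) ≤ ENNReal.ofReal (Real.exp (s ^ 2 * L ^ 2 * v * Fintype.card ι)) := by
  let e := MeasurableEquiv.piCongrLeft (fun _ : ι => ℝ) (Fintype.equivFin ι).symm
  have he : MeasurePreserving e (gaussianPi (Fin (Fintype.card ι)) v) (gaussianPi ι v) :=
    measurePreserving_piCongrLeft (fun _ : ι => gaussianReal 0 v) (Fintype.equivFin ι).symm
  have hFc := continuous_of_abs_sub_le_sum hF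
  have := lintegral_exp_le_fin v (L := L) s (Fintype.card ι) (fun x => F (e x)) fun x y => by
    refine (hF _ _).trans_eq ?_
    congr 1
    rw [← (Fintype.equivFin ι).symm.sum_comp]
    refine Finset.sum_congr rfl fun i _ => ?_
    simp only [e, MeasurableEquiv.coe_piCongrLeft, Equiv.piCongrLeft_apply_apply]
  rwa [he.integral_comp' (f := e) F, he.lintegral_comp (f := fun x =>
    ENNReal.ofReal (Real.exp (s * (F x - ∫ y, F y ∂(gaussianPi ι v))))) (by fun_prop)] at this

/-- Gaussian concentration for functions that are Lipschitz in every coordinate. -/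
lemma measure_ge_integral_add_le (v : ℝ≥0) {L : ℝ} (F : (ι → ℝ) → ℝ)
    (hF : ∀ x y, |F x - F y| ≤ L * ∑ i, |x i - y i|) {D t : ℝ} (hD : 0 < D)
    (hLD : L ^ 2 * v * Fintype.card ι ≤ D) (ht : 0 ≤ t) :
    (gaussianPi ι v).real {x | (∫ y, F y ∂(gaussianPi ι v)) + t ≤ F x} ≤
      Real.exp (-t ^ 2 / (4 * D)) := by
  have hFc := continuous_of_abs_sub_le_sum hF
  set m := ∫ y, F y ∂(gaussianPi ι v) with hm
  -- The minimiser of the Chernoff exponent $s^2D-st$.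
  let s := t / (2 * D)
  have hs : 0 ≤ s := by positivity
  have h1 := lintegral_exp_le v (L := L) s F hF
  have h2 := meas_ge_le_lintegral_div (μ := gaussianPi ι v)
    (f := fun x => ENNReal.ofReal (Real.exp (s * (F x - m))))
    (Measurable.aemeasurable (by fun_prop)) (ε := ENNReal.ofReal (Real.exp (s * t)))
    (by simp [Real.exp_pos]) (by simp)
  have hsub : {x | m + t ≤ F x} ⊆ {x | ENNReal.ofReal (Real.exp (s * t)) ≤
      ENNReal.ofReal (Real.exp (s * (F x - m)))} := fun x hx => by
    simp only [Set.mem_ofPred_eq] at hx ⊢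
    refine ENNReal.ofReal_le_ofReal (Real.exp_le_exp.2 ?_)
    gcongr; linarith
  refine ENNReal.toReal_le_of_le_ofReal (by positivity) ?_
  refine (measure_mono hsub).trans (h2.trans ?_)
  refine (ENNReal.div_le_div_right h1 _).trans ?_
  rw [← ENNReal.ofReal_div_of_pos (by positivity), ← Real.exp_sub]
  refine ENNReal.ofReal_le_ofReal (Real.exp_le_exp.2 ?_)
  have : s ^ 2 * L ^ 2 * v * Fintype.card ι ≤ s ^ 2 * D := by
    have := mul_le_mul_of_nonneg_left hLD (sq_nonneg s)
    linarith
  have e : s ^ 2 * D - s * t = -t ^ 2 / (4 * D) := by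
    simp only [s]; field_simp; ring
  linarith

end Concentration

end PSpin

/-! ### The injective norm of a Gaussian tensor. -/

namespace PSpin

variable {p N : ℕ}

/-- The `p`-linear form `A(u_1, …, u_p)` of a tensor. -/
noncomputable def Tensor.multiform (A : Tensor p N) :
    MultilinearMap ℝ (fun _ : Fin p => Vec N) ℝ :=
  ∑ J : Fin p → Fin N, A J • (MultilinearMap.mkPiAlgebra ℝ (Fin p) ℝ).compLinearMap
    fun k => (EuclideanSpace.proj (J k) : Vec N →L[ℝ] ℝ).toLinearMap

lemma multiform_apply (A : Tensor p N) (u : Fin p → Vec N) :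
    A.multiform u = ∑ J : Fin p → Fin N, A J * ∏ k, u k (J k) := by
  simp [Tensor.multiform]

lemma form_eq_multiform (A : Tensor p N) (u : Vec N) : A.form u = A.multiform fun _ => u := by
  rw [multiform_apply, Tensor.form]

lemma multiform_add_smul (a b : ℝ) (A B : Tensor p N) (u : Fin p → Vec N) :
    (a • A + b • B).multiform u = a * A.multiform u + b * B.multiform u := by
  simp only [multiform_apply, Finset.mul_sum, ← Finset.sum_add_distrib]
  refine Finset.sum_congr rfl fun J _ => ?_
  simp only [Pi.add_apply, Pi.smul_apply, smul_eq_mul]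
  ring

/-- A bound on the injective norm of a tensor, normalised so that `C` is of order one for a
Gaussian tensor. -/
def InjBound (A : Tensor p N) (C : ℝ) : Prop :=
  ∀ u : Fin p → Vec N, |A.multiform u| ≤ C * N * ∏ k, (‖u k‖ / √N)

lemma InjBound.add_smul {A B : Tensor p N} {C D : ℝ} (hA : InjBound A C) (hB : InjBound B D)
    (a b : ℝ) : InjBound (a • A + b • B) (|a| * C + |b| * D) := fun u => by
  rw [multiform_add_smul]
  refine (abs_add_le _ _).trans ?_
  rw [abs_mul, abs_mul]
  have h1 := mul_le_mul_of_nonneg_left (hA u) (abs_nonneg a)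
  have h2 := mul_le_mul_of_nonneg_left (hB u) (abs_nonneg b)
  linarith

/-- A `1/2`-net of the Euclidean unit ball of `ℝ^N` with at most `5^N` points. -/
lemma exists_net (N : ℕ) : ∃ s : Finset (Vec N), s.card ≤ 5 ^ N ∧ (∀ y ∈ s, ‖y‖ ≤ 1) ∧
    ∀ x : Vec N, ‖x‖ ≤ 1 → ∃ y ∈ s, ‖x - y‖ ≤ 1 / 2 := by
  classical
  have hcard : ∀ s : Finset (Vec N), (∀ y ∈ s, ‖y‖ ≤ 1) →
      (∀ c ∈ s, ∀ d ∈ s, c ≠ d → 1 / 2 ≤ ‖c - d‖) → s.card ≤ 5 ^ N := by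
    intro s h1 h2
    have hinj : Function.Injective fun y : Vec N => (2 : ℝ) • y := smul_right_injective _ two_ne_zero
    have := Besicovitch.card_le_of_separated (s.image fun y => (2 : ℝ) • y) (fun c hc => by
      obtain ⟨y, hy, rfl⟩ := Finset.mem_image.1 hc
      rw [norm_smul, Real.norm_ofNat]
      linarith [h1 y hy]) (fun c hc d hd hcd => by
      obtain ⟨y, hy, rfl⟩ := Finset.mem_image.1 hc
      obtain ⟨z, hz, rfl⟩ := Finset.mem_image.1 hd
      rw [← smul_sub, norm_smul, Real.norm_ofNat]
      linarith [h2 y hy z hz fun h => hcd (by rw [h])])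
    rwa [Finset.card_image_of_injective _ hinj, finrank_euclideanSpace_fin] at this
  by_contra! hcon
  -- If no separated set were a net, points could be added greedily for ever, against the packing
  -- bound.
  have hall : ∀ n : ℕ, ∃ s : Finset (Vec N), s.card = n ∧ (∀ y ∈ s, ‖y‖ ≤ 1) ∧
      ∀ c ∈ s, ∀ d ∈ s, c ≠ d → 1 / 2 ≤ ‖c - d‖ := by
    intro n
    induction n with
    | zero => exact ⟨∅, by simp⟩
    | succ n ih =>
      obtain ⟨s, hs, h1, h2⟩ := ih
      obtain ⟨x, hx, hxs⟩ := hcon s (hcard s h1 h2) h1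
      refine ⟨insert x s, ?_, ?_, ?_⟩
      · rw [Finset.card_insert_of_notMem, hs]
        intro hmem
        have := hxs x hmem
        norm_num at this
      · intro y hy
        rcases Finset.mem_insert.1 hy with rfl | hy
        exacts [hx, h1 y hy]
      · intro c hc d hd hcd
        rcases Finset.mem_insert.1 hc with rfl | hc' <;> rcases Finset.mem_insert.1 hd with rfl | hd'
        · exact absurd rfl hcd
        · exact (hxs d hd').le
        · rw [norm_sub_rev]; exact (hxs c hc').le
        · exact h2 c hc' d hd' hcd
  obtain ⟨s, hs, h1, h2⟩ := hall (5 ^ N + 1)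
  have := hcard s h1 h2
  omega

/-- Moving a unit vector to the nearest net point costs at most half the operator norm, so $\|l\|\le
b+\|l\|/2$. -/
lemma abs_le_of_net {s : Finset (Vec N)}
    (hs : ∀ x : Vec N, ‖x‖ ≤ 1 → ∃ y ∈ s, ‖x - y‖ ≤ 1 / 2) (l : Vec N →ₗ[ℝ] ℝ) {b : ℝ}
    (hb : ∀ y ∈ s, |l y| ≤ b) (x : Vec N) : |l x| ≤ 2 * b * ‖x‖ := by
  let L : Vec N →L[ℝ] ℝ := l.toContinuousLinearMap
  have hb0 : 0 ≤ b := by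
    obtain ⟨y, hy, _⟩ := hs 0 (by simp)
    exact (abs_nonneg _).trans (hb y hy)
  have hM : ‖L‖ ≤ b + ‖L‖ / 2 := by
    refine ContinuousLinearMap.opNorm_le_of_unit_norm (by positivity) fun x hx => ?_
    obtain ⟨y, hy, hxy⟩ := hs x hx.le
    have h1 : L x = L y + L (x - y) := by rw [← map_add]; congr 1; abel
    have h2 : ‖L (x - y)‖ ≤ ‖L‖ / 2 := (L.le_opNorm _).trans (by nlinarith [norm_nonneg L])
    rw [h1]
    exact (norm_add_le _ _).trans (add_le_add (hb y hy) h2)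
  have := L.le_opNorm x
  have h3 : ‖L‖ * ‖x‖ ≤ 2 * b * ‖x‖ := by gcongr; linarith
  exact this.trans h3

/-- The arguments are released from the net one at a time; each is a linear functional and costs a
factor 2. -/
lemma abs_multiform_le_of_net {s : Finset (Vec N)}
    (hs : ∀ x : Vec N, ‖x‖ ≤ 1 → ∃ y ∈ s, ‖x - y‖ ≤ 1 / 2)
    (m : MultilinearMap ℝ (fun _ : Fin p => Vec N) ℝ) {b : ℝ}
    (hb : ∀ y : Fin p → Vec N, (∀ k, y k ∈ s) → |m y| ≤ b) (u : Fin p → Vec N) :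
    |m u| ≤ 2 ^ p * b * ∏ k, ‖u k‖ := by
  classical
  have key : ∀ T : Finset (Fin p), ∀ u : Fin p → Vec N, (∀ k ∉ T, u k ∈ s) →
      |m u| ≤ 2 ^ T.card * b * ∏ k ∈ T, ‖u k‖ := by
    intro T
    induction T using Finset.induction_on with
    | empty => intro u hu; simpa using hb u fun k => hu k (by simp)
    | insert k T hk ih =>
      intro u hu
      have := abs_le_of_net hs (m.toLinearMap u k) (b := 2 ^ T.card * b * ∏ j ∈ T, ‖u j‖)
        (fun y hy => by
          rw [MultilinearMap.toLinearMap_apply]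
          refine (ih _ fun j hj => ?_).trans_eq ?_
          · by_cases hjk : j = k
            · subst hjk; simpa using hy
            · rw [Function.update_of_ne hjk]
              exact hu j (by simp [hjk, hj])
          · congr 1
            refine Finset.prod_congr rfl fun j hj => ?_
            rw [Function.update_of_ne]
            rintro rfl; exact hk hj) (u k)
      rw [MultilinearMap.toLinearMap_apply, Function.update_eq_self] at this
      refine this.trans_eq ?_
      rw [Finset.prod_insert hk, Finset.card_insert_of_notMem hk]
      ring
  simpa using key Finset.univ u (by simp)

lemma sum_prod_sq (y : Fin p → Vec N) :
    ∑ J : Fin p → Fin N, (∏ k, y k (J k)) ^ 2 = ∏ k, ‖y k‖ ^ 2 := by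
  simp_rw [EuclideanSpace.norm_sq_eq, Real.norm_eq_abs, sq_abs, ← Finset.prod_pow]
  rw [Finset.prod_univ_sum, Fintype.piFinset_univ]

lemma gaussianTensor_eq (p N : ℕ) :
    gaussianTensor p N = gaussianPi (Fin p → Fin N) ((N : ℝ≥0) ^ (p - 1))⁻¹ := rfl

instance (p N : ℕ) : IsProbabilityMeasure (gaussianTensor p N) := by
  rw [gaussianTensor_eq]; infer_instance

/-- The injective norm of a Gaussian tensor is of the normalised order, outside an event of
exponentially small probability. -/
lemma exists_injBound (p : ℕ) (hp : 0 < p) : ∃ C : ℝ, 0 < C ∧ ∀ N : ℕ, 0 < N →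
    (gaussianTensor p N).real {A | ¬ InjBound A C} ≤ Real.exp (-N) := by
  classical
  -- Chosen so that the Gaussian exponent is $(2p+3)N$: the net of $p$-tuples has at most $5^{pN}\le
  -- e^{2pN}$ points and the factor 2 is at most $e^N$.
  set C' := √(4 * p + 6) with hC'
  have hC'0 : 0 < C' := by positivity
  refine ⟨2 ^ p * C', by positivity, fun N hN => ?_⟩
  have hNr : (0 : ℝ) < N := by exact_mod_cast hN
  have hsN : 0 < √(N : ℝ) := by positivity
  obtain ⟨s, hcard, hs1, hs⟩ := exists_net N
  set b := C' * N / √N ^ p with hb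
  set P := Fintype.piFinset fun _ : Fin p => s with hP
  have hsub : {A : Tensor p N | ¬ InjBound A (2 ^ p * C')} ⊆
      ⋃ y ∈ P, {A : Tensor p N | b ≤ |∑ J, (∏ k, y k (J k)) * A J|} := by
    intro A hA
    by_contra hcon
    simp only [Set.mem_iUnion, Set.mem_ofPred_eq, not_exists, not_le, exists_prop, not_and] at hcon
    apply hA
    intro u
    refine (abs_multiform_le_of_net hs A.multiform (b := b) (fun y hy => ?_) u).trans_eq ?_
    · have := hcon y (Fintype.mem_piFinset.2 hy)
      rw [multiform_apply]
      simp_rw [mul_comm (A _)]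
      exact this.le
    · rw [Finset.prod_div_distrib, Finset.prod_const, Finset.card_univ, Fintype.card_fin, hb]
      field_simp
  set v : ℝ≥0 := ((N : ℝ≥0) ^ (p - 1))⁻¹
  have hv : (v : ℝ) = ((N : ℝ) ^ (p - 1))⁻¹ := by simp [v]
  have hv0 : (0 : ℝ) < v := by rw [hv]; positivity
  have hexp : -b ^ 2 / (2 * v) = -((2 * p + 3) * N) := by
    have e1 : (√(N : ℝ) ^ p) ^ 2 = N ^ (p - 1) * N := by
      rw [← pow_mul, mul_comm p 2, pow_mul, Real.sq_sqrt hNr.le, ← pow_succ]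
      congr 1; omega
    rw [hb, hv, div_pow, e1, mul_pow, hC', Real.sq_sqrt (by positivity)]
    field_simp
    ring
  have hone : ∀ y ∈ P, (gaussianTensor p N).real
      {A : Tensor p N | b ≤ |∑ J, (∏ k, y k (J k)) * A J|} ≤
        2 * Real.exp (-((2 * p + 3) * N)) := by
    intro y hy
    rw [← hexp]
    refine measure_abs_sum_ge_le v _ (by positivity) hv0 ?_
    rw [sum_prod_sq]
    refine mul_le_of_le_one_right hv0.le (Finset.prod_le_one (fun _ _ => by positivity) fun k _ => ?_)
    exact pow_le_one₀ (norm_nonneg _) (hs1 _ (Fintype.mem_piFinset.1 hy k))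
  have hPcard : (P.card : ℝ) ≤ Real.exp (2 * p * N) := by
    rw [hP, Fintype.card_piFinset_const]
    have h5 : (5 : ℝ) ≤ Real.exp 2 := by
      have := Real.add_one_le_exp (1 : ℝ)
      have h2 := Real.exp_one_gt_d9
      have : Real.exp 2 = Real.exp 1 * Real.exp 1 := by rw [← Real.exp_add]; norm_num
      nlinarith
    have h6 : (s.card : ℝ) ≤ Real.exp 2 ^ N :=
      calc (s.card : ℝ) ≤ 5 ^ N := by exact_mod_cast hcard
        _ ≤ _ := by gcongr
    push_cast
    calc (s.card : ℝ) ^ p ≤ (Real.exp 2 ^ N) ^ p := by gcongr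
      _ = _ := by rw [← Real.exp_nat_mul, ← Real.exp_nat_mul]; congr 1; ring
  have h2 : (2 : ℝ) ≤ Real.exp N := by
    have := Real.add_one_le_exp (N : ℝ)
    have : (1 : ℝ) ≤ N := by exact_mod_cast hN
    linarith
  calc (gaussianTensor p N).real {A | ¬ InjBound A (2 ^ p * C')}
      ≤ (gaussianTensor p N).real (⋃ y ∈ P, {A : Tensor p N | b ≤ |∑ J, (∏ k, y k (J k)) * A J|}) :=
        measureReal_mono hsub (measure_ne_top _ _)
    _ ≤ ∑ y ∈ P, (gaussianTensor p N).real {A : Tensor p N | b ≤ |∑ J, (∏ k, y k (J k)) * A J|} :=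
        measureReal_biUnion_finset_le _ _
    _ ≤ P.card * (2 * Real.exp (-((2 * p + 3) * N))) := by
        rw [← nsmul_eq_mul]; exact Finset.sum_le_card_nsmul _ _ _ hone
    _ ≤ Real.exp (2 * p * N) * (Real.exp N * Real.exp (-((2 * p + 3) * N))) := by gcongr
    _ = Real.exp (-(2 * N)) := by rw [← Real.exp_add, ← Real.exp_add]; congr 1; ring
    _ ≤ _ := Real.exp_le_exp.2 (by linarith)

end PSpin

/-! ### Ground state over the corners against the infimum over the cube. -/

namespace PSpin

variable {p N : ℕ}

section Corner

variable {ι κ τ : Type*} [DecidableEq ι] [Fintype κ]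

lemma prod_update_eq_add_mul {g : κ → ι} (hg : Function.Injective g) (x : ι → ℝ) (i : ι) :
    ∃ a b : ℝ, ∀ t, ∏ k, Function.update x i t (g k) = a + b * t := by
  classical
  by_cases h : ∃ k, g k = i
  · obtain ⟨k, rfl⟩ := h
    refine ⟨0, ∏ l ∈ Finset.univ.erase k, x (g l), fun t => ?_⟩
    rw [← Finset.mul_prod_erase _ _ (Finset.mem_univ k), Function.update_self, zero_add, mul_comm]
    congr 1
    refine Finset.prod_congr rfl fun l hl => ?_
    rw [Function.update_of_ne fun h => (Finset.ne_of_mem_erase hl) (hg h)]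
  · push Not at h
    refine ⟨∏ k, x (g k), 0, fun t => ?_⟩
    rw [zero_mul, add_zero]
    exact Finset.prod_congr rfl fun l _ => by rw [Function.update_of_ne (h l)]

/-- A square-free polynomial attains its minimum over `[-1, 1]^ι` at a corner. -/
lemma exists_corner_le [Fintype ι] (T : Finset τ) (c : τ → ℝ) (g : τ → κ → ι)
    (hg : ∀ j ∈ T, Function.Injective (g j)) (x : ι → ℝ) (hx : ∀ i, x i ∈ Set.Icc (-1 : ℝ) 1) :
    ∃ σ : ι → ℝ, (∀ i, σ i = -1 ∨ σ i = 1) ∧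
      ∑ j ∈ T, c j * ∏ k, σ (g j k) ≤ ∑ j ∈ T, c j * ∏ k, x (g j k) := by
  -- By injectivity each variable occurs at most once in a monomial, so the polynomial is affine in
  -- each coordinate and the coordinates can be pushed to `±1` one by one.
  have haff : ∀ (y : ι → ℝ) (i : ι), ∃ a b : ℝ, ∀ t,
      ∑ j ∈ T, c j * ∏ k, Function.update y i t (g j k) = a + b * t := by
    intro y i
    choose! a b hab using fun j hj => prod_update_eq_add_mul (hg j hj) y i
    refine ⟨∑ j ∈ T, c j * a j, ∑ j ∈ T, c j * b j, fun t => ?_⟩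
    rw [Finset.sum_mul, ← Finset.sum_add_distrib]
    exact Finset.sum_congr rfl fun j hj => by rw [hab j hj]; ring
  have key : ∀ S : Finset ι, ∃ σ : ι → ℝ, (∀ i ∈ S, σ i = -1 ∨ σ i = 1) ∧
      (∀ i ∉ S, σ i = x i) ∧
      ∑ j ∈ T, c j * ∏ k, σ (g j k) ≤ ∑ j ∈ T, c j * ∏ k, x (g j k) := by
    intro S
    induction S using Finset.induction_on with
    | empty => exact ⟨x, by simp, by simp, le_rfl⟩
    | insert i S hi ih =>
      obtain ⟨σ, h1, h2, h3⟩ := ih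
      obtain ⟨a, b, hab⟩ := haff σ i
      obtain ⟨t, ht, hle⟩ : ∃ t : ℝ, (t = -1 ∨ t = 1) ∧ a + b * t ≤ a + b * σ i := by
        have hxi := hx i
        rw [← h2 i hi] at hxi
        rcases le_total 0 b with hb | hb
        · exact ⟨-1, .inl rfl, by nlinarith [hxi.1]⟩
        · exact ⟨1, .inr rfl, by nlinarith [hxi.2]⟩
      refine ⟨Function.update σ i t, fun l hl => ?_, fun l hl => ?_, ?_⟩
      · by_cases hli : l = i
        · subst hli; simpa using ht
        · rw [Function.update_of_ne hli]
          exact h1 l (Finset.mem_of_mem_insert_of_ne hl hli)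
      · rw [Finset.mem_insert, not_or] at hl
        rw [Function.update_of_ne hl.1]
        exact h2 l hl.2
      · rw [hab t]
        refine hle.trans ?_
        rw [← hab (σ i), Function.update_eq_self]
        exact h3
  obtain ⟨σ, h1, _, h3⟩ := key Finset.univ
  exact ⟨σ, fun i => h1 i (Finset.mem_univ i), h3⟩

end Corner

lemma binaryCube_subset_cube : binaryCube N ⊆ cube N := fun σ hσ i => by
  rcases hσ i with h | h <;> rw [h] <;> norm_num

lemma binaryCube_nonempty : (binaryCube N).Nonempty :=
  ⟨WithLp.toLp 2 fun _ => 1, fun _ => .inr rfl⟩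

lemma abs_sum_mul_prod_le (c : (Fin p → Fin N) → ℝ) {x : Vec N} (hx : x ∈ cube N) :
    |∑ J, c J * ∏ k, x (J k)| ≤ ∑ J, |c J| := by
  refine (Finset.abs_sum_le_sum_abs _ _).trans (Finset.sum_le_sum fun J _ => ?_)
  rw [abs_mul, Finset.abs_prod]
  exact mul_le_of_le_one_right (abs_nonneg _)
    (Finset.prod_le_one (fun _ _ => abs_nonneg _) fun k _ => abs_le.2 (hx (J k)))

lemma abs_form_le (A : Tensor p N) {x : Vec N} (hx : x ∈ cube N) : |A.form x| ≤ ∑ J, |A J| :=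
  abs_sum_mul_prod_le A hx

lemma bddBelow_form (A : Tensor p N) : BddBelow (A.form '' cube N) := by
  refine ⟨-∑ J, |A J|, ?_⟩
  rintro _ ⟨x, hx, rfl⟩
  exact (abs_le.1 (abs_form_le A hx)).1

lemma bddBelow_form_binaryCube (A : Tensor p N) : BddBelow (A.form '' binaryCube N) :=
  (bddBelow_form A).mono (Set.image_mono binaryCube_subset_cube)

lemma groundState_le (A : Tensor p N) {σ : Vec N} (hσ : σ ∈ binaryCube N) :
    groundState A ≤ A.form σ / N :=
  div_le_div_of_nonneg_right (csInf_le (bddBelow_form_binaryCube A) ⟨σ, hσ, rfl⟩) (by positivity)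

lemma groundState_sub_le (A B : Tensor p N) :
    groundState A - groundState B ≤ (N : ℝ)⁻¹ * ∑ J, |A J - B J| := by
  have h : sInf (A.form '' binaryCube N) - ∑ J, |A J - B J| ≤ sInf (B.form '' binaryCube N) := by
    refine le_csInf (binaryCube_nonempty.image _) ?_
    rintro _ ⟨σ, hσ, rfl⟩
    have h1 := csInf_le (bddBelow_form_binaryCube A) ⟨σ, hσ, rfl⟩
    have h2 := abs_sum_mul_prod_le (fun J => A J - B J) (binaryCube_subset_cube hσ)
    have h3 : ∑ J, (A J - B J) * ∏ k, σ (J k) = A.form σ - B.form σ := by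
      simp only [Tensor.form, ← Finset.sum_sub_distrib, sub_mul]
    rw [h3] at h2
    linarith [(abs_le.1 h2).2]
  rw [groundState, groundState, ← sub_div, div_eq_inv_mul]
  gcongr
  linarith

lemma abs_groundState_sub_le (A B : Tensor p N) :
    |groundState A - groundState B| ≤ (N : ℝ)⁻¹ * ∑ J, |A J - B J| := by
  rw [abs_le]
  refine ⟨?_, groundState_sub_le A B⟩
  have := groundState_sub_le B A
  simp_rw [abs_sub_comm (B _)] at this
  linarith

lemma continuous_groundState : Continuous (groundState : Tensor p N → ℝ) :=
  continuous_of_abs_sub_le_sum abs_groundState_sub_le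

lemma integrable_groundState : Integrable groundState (gaussianTensor p N) :=
  integrable_of_abs_sub_le_sum _ abs_groundState_sub_le

/-- Upper tail of the ground state energy. -/
lemma measure_groundState_ge_le (hp : 0 < p) (hN : 0 < N) {t : ℝ} (ht : 0 ≤ t) :
    (gaussianTensor p N).real {A | ∫ B, groundState B ∂(gaussianTensor p N) + t ≤ groundState A} ≤
      Real.exp (-(t ^ 2 / 4) * N) := by
  have hNr : (0 : ℝ) < N := by exact_mod_cast hN
  -- The variance proxy is $N^{-2}\cdot N^{-(p-1)}\cdot N^p=1/N$.
  have h := measure_ge_integral_add_le ((N : ℝ≥0) ^ (p - 1))⁻¹ (groundState : Tensor p N → ℝ)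
    abs_groundState_sub_le (D := (N : ℝ)⁻¹) (by positivity) ?_ ht
  · refine h.trans_eq ?_
    congr 1; field_simp
  · obtain ⟨q, rfl⟩ : ∃ q, p = q + 1 := ⟨p - 1, by omega⟩
    simp only [add_tsub_cancel_right, Fintype.card_fun, Fintype.card_fin]
    push_cast
    apply le_of_eq
    field_simp
    ring

lemma card_not_injective_le (p N : ℕ) :
    (Finset.univ.filter fun J : Fin p → Fin N => ¬ Function.Injective J).card ≤
      p ^ 2 * N ^ (p - 1) := by
  classical
  have hpair : ∀ ab : Fin p × Fin p, ab.1 ≠ ab.2 →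
      (Finset.univ.filter fun J : Fin p → Fin N => J ab.1 = J ab.2).card ≤ N ^ (p - 1) := by
    intro ab hab
    have hc : Fintype.card ({k : Fin p // k ≠ ab.1} → Fin N) = N ^ (p - 1) := by
      simp
    rw [← hc, ← Finset.card_univ]
    refine Finset.card_le_card_of_injOn (fun J k => J k) (by simp) ?_
    intro J hJ J' hJ' h
    simp only [Finset.coe_filter, Finset.mem_univ, true_and, Set.mem_ofPred_eq] at hJ hJ'
    have h' : ∀ k, k ≠ ab.1 → J k = J' k := fun k hk => congrFun h ⟨k, hk⟩
    funext k
    by_cases hk : k = ab.1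
    · rw [hk, hJ, hJ', h' _ hab.symm]
    · exact h' k hk
  calc _ ≤ ((Finset.univ.filter fun ab : Fin p × Fin p => ab.1 ≠ ab.2).biUnion fun ab =>
          Finset.univ.filter fun J : Fin p → Fin N => J ab.1 = J ab.2).card := by
        refine Finset.card_le_card fun J hJ => ?_
        have hJ' := (Finset.mem_filter.1 hJ).2
        rw [Function.Injective] at hJ'
        push Not at hJ'
        obtain ⟨a, b, hab, hne⟩ := hJ'
        simp only [Finset.mem_biUnion, Finset.mem_filter, Finset.mem_univ, true_and]
        exact ⟨(a, b), hne, hab⟩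
    _ ≤ (Finset.univ.filter fun ab : Fin p × Fin p => ab.1 ≠ ab.2).card * N ^ (p - 1) := by
        refine Finset.card_biUnion_le_card_mul _ _ _ fun ab hab => hpair ab ?_
        simpa using hab
    _ ≤ _ := by
        gcongr
        refine (Finset.card_filter_le _ _).trans ?_
        simp [pow_two]

/-- If the part of the tensor with repeated indices is small at all corners, then the ground state
over the corners is close to the infimum over the cube. -/
lemma groundState_le_sInf_add (hN : 0 < N) (A : Tensor p N) {b : ℝ}
    (h : ∀ σ : Fin p × Fin N → ℝ, (∀ i, σ i = -1 ∨ σ i = 1) →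
      |∑ J ∈ Finset.univ.filter fun J : Fin p → Fin N => ¬ Function.Injective J,
        A J * ∏ k, σ (k, J k)| ≤ b * N) :
    groundState A ≤ sInf (A.form '' cube N) / N + 2 * b := by
  classical
  have hNr : (0 : ℝ) < N := by exact_mod_cast hN
  set T := Finset.univ.filter fun J : Fin p → Fin N => ¬ Function.Injective J
  -- Monomials with repeated indices are not square-free. Giving each of the `p` slots its own
  -- variables makes them so, and corners of the larger cube then bound this part on all of the
  -- original cube.
  have hD : ∀ x ∈ cube N, |∑ J ∈ T, A J * ∏ k, x (J k)| ≤ b * N := by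
    intro x hx
    have hg : ∀ J ∈ T, Function.Injective fun k : Fin p => (k, J k) :=
      fun J _ k l hkl => (Prod.ext_iff.1 hkl).1
    obtain ⟨σ, hσ, h1⟩ := exists_corner_le T A (fun J k => (k, J k)) hg
      (fun z : Fin p × Fin N => x z.2) fun z => hx z.2
    obtain ⟨σ', hσ', h2⟩ := exists_corner_le T (fun J => -A J) (fun J k => (k, J k)) hg
      (fun z : Fin p × Fin N => x z.2) fun z => hx z.2
    simp only [neg_mul, Finset.sum_neg_distrib] at h2
    have := abs_le.1 (h σ hσ)
    have := abs_le.1 (h σ' hσ')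
    rw [abs_le]
    constructor <;> linarith
  have hsplit : ∀ x : Vec N, A.form x = ∑ J ∈ T, A J * ∏ k, x (J k) +
      ∑ J ∈ Finset.univ.filter fun J : Fin p → Fin N => Function.Injective J,
        A J * ∏ k, x (J k) := fun x => by
    rw [add_comm, Tensor.form]
    exact (Finset.sum_filter_add_sum_filter_not _ _ _).symm
  have hx : ∀ x ∈ cube N, (groundState A - 2 * b) * N ≤ A.form x := by
    intro x hx
    obtain ⟨σ, hσ, h1⟩ := exists_corner_le
      (Finset.univ.filter fun J : Fin p → Fin N => Function.Injective J) A (fun J => J)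
      (fun J hJ => (Finset.mem_filter.1 hJ).2) (fun i => x i) hx
    have hσ' : (WithLp.toLp 2 σ : Vec N) ∈ binaryCube N := hσ
    have h2 := groundState_le A hσ'
    rw [le_div_iff₀ hNr, hsplit] at h2
    have h3 := abs_le.1 (hD _ (binaryCube_subset_cube hσ'))
    have h4 := abs_le.1 (hD x hx)
    rw [hsplit x]
    simp only at h2 h3
    linarith
  have : (groundState A - 2 * b) * N ≤ sInf (A.form '' cube N) := by
    refine le_csInf ((binaryCube_nonempty.mono binaryCube_subset_cube).image _) ?_
    rintro _ ⟨x, hxc, rfl⟩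
    exact hx x hxc
  rw [← le_div_iff₀ hNr] at this
  linarith

/-- Only $O(N^{p-1})$ index tuples have a repetition, so at a fixed corner their contribution has
variance at most $p^2$, and a deviation of size $bN$ has probability $e^{-\Omega(N^2)}$. This beats
the union over $2^{pN}$ decoupled corners. -/
lemma eventually_measure_groundState_gt_le (hp : 0 < p) {b : ℝ} (hb : 0 < b) :
    ∀ᶠ N : ℕ in atTop, (gaussianTensor p N).real
      {A | ¬ groundState A ≤ sInf (A.form '' cube N) / N + 2 * b} ≤ Real.exp (-N) := by
  classical
  have hp0 : (0 : ℝ) < p := by exact_mod_cast hp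
  -- From here on $b^2N^2/(2p^2)\ge(p+2)N$. Of this, $pN$ pays for the corners and $N$ for the
  -- factor 2.
  obtain ⟨N₀, hN₀⟩ := exists_nat_gt ((p + 2) * (2 * p ^ 2) / b ^ 2)
  filter_upwards [eventually_gt_atTop 0, eventually_ge_atTop N₀] with N hN hNN
  have hNr : (0 : ℝ) < N := by exact_mod_cast hN
  have hNb : (p + 2) * (2 * p ^ 2) ≤ b ^ 2 * N := by
    have : (N₀ : ℝ) ≤ N := by exact_mod_cast hNN
    have := (div_lt_iff₀ (by positivity)).1 (hN₀.trans_le this)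
    linarith
  set T := Finset.univ.filter fun J : Fin p → Fin N => ¬ Function.Injective J with hT
  set P := Fintype.piFinset fun _ : Fin p × Fin N => ({-1, 1} : Finset ℝ) with hP
  have hsub : {A : Tensor p N | ¬ groundState A ≤ sInf (A.form '' cube N) / N + 2 * b} ⊆
      ⋃ σ ∈ P, {A : Tensor p N | b * N ≤
        |∑ J, (if J ∈ T then ∏ k, σ (k, J k) else 0) * A J|} := by
    intro A hA
    by_contra hcon
    simp only [Set.mem_iUnion, Set.mem_ofPred_eq, not_exists, not_le, exists_prop, not_and] at hcon
    refine hA (groundState_le_sInf_add hN A fun σ hσ => ?_)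
    refine le_trans (le_of_eq ?_) (hcon σ (Fintype.mem_piFinset.2 fun i => by simpa using hσ i)).le
    congr 1
    simp only [ite_mul, zero_mul, Finset.sum_ite_mem, Finset.univ_inter]
    exact Finset.sum_congr rfl fun J _ => mul_comm _ _
  have hone : ∀ σ ∈ P, (gaussianTensor p N).real {A : Tensor p N | b * N ≤
        |∑ J, (if J ∈ T then ∏ k, σ (k, J k) else 0) * A J|} ≤
      2 * Real.exp (-((p + 2) * N)) := by
    intro σ hσ
    have hσ1 : ∀ i, σ i ^ 2 = 1 := fun i => by
      have := Fintype.mem_piFinset.1 hσ i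
      simp only [Finset.mem_insert, Finset.mem_singleton] at this
      rcases this with h | h <;> rw [h] <;> norm_num
    have := measure_abs_sum_ge_le ((N : ℝ≥0) ^ (p - 1))⁻¹
      (fun J => if J ∈ T then ∏ k, σ (k, J k) else 0) (t := b * N) (D := p ^ 2)
      (by positivity) (by positivity) (by
        have h1 : ∀ J : Fin p → Fin N, (if J ∈ T then ∏ k, σ (k, J k) else 0) ^ 2 =
            if J ∈ T then (1 : ℝ) else 0 := fun J => by
          split_ifs
          · rw [← Finset.prod_pow]; exact Finset.prod_eq_one fun k _ => hσ1 _
          · norm_num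
        simp_rw [h1]
        rw [Finset.sum_ite_mem, Finset.univ_inter, Finset.sum_const, nsmul_eq_mul, mul_one]
        have h2 : (T.card : ℝ) ≤ p ^ 2 * N ^ (p - 1) := by
          exact_mod_cast card_not_injective_le p N
        push_cast
        rw [inv_mul_le_iff₀ (by positivity)]
        linarith)
    refine this.trans ?_
    gcongr
    rw [div_le_iff₀ (by positivity)]
    nlinarith
  have hPcard : (P.card : ℝ) ≤ Real.exp (p * N) := by
    rw [hP, Fintype.card_piFinset, Finset.prod_const, Finset.card_pair (by norm_num),
      Finset.card_univ, Fintype.card_prod,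
      Fintype.card_fin, Fintype.card_fin]
    have h2 : (2 : ℝ) ≤ Real.exp 1 := by have := Real.add_one_le_exp (1 : ℝ); linarith
    push_cast
    calc (2 : ℝ) ^ (p * N) ≤ Real.exp 1 ^ (p * N) := by gcongr
      _ = _ := by rw [← Real.exp_nat_mul]; push_cast; rw [mul_one]
  have h2 : (2 : ℝ) ≤ Real.exp N := by
    have := Real.add_one_le_exp (N : ℝ)
    have : (1 : ℝ) ≤ N := by exact_mod_cast hN
    linarith
  calc _ ≤ (gaussianTensor p N).real (⋃ σ ∈ P, {A : Tensor p N | b * N ≤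
        |∑ J, (if J ∈ T then ∏ k, σ (k, J k) else 0) * A J|}) :=
        measureReal_mono hsub (measure_ne_top _ _)
    _ ≤ ∑ σ ∈ P, (gaussianTensor p N).real {A : Tensor p N | b * N ≤
        |∑ J, (if J ∈ T then ∏ k, σ (k, J k) else 0) * A J|} :=
        measureReal_biUnion_finset_le _ _
    _ ≤ P.card * (2 * Real.exp (-((p + 2) * N))) := by
        rw [← nsmul_eq_mul]; exact Finset.sum_le_card_nsmul _ _ _ hone
    _ ≤ Real.exp (p * N) * (Real.exp N * Real.exp (-((p + 2) * N))) := by gcongr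
    _ = _ := by rw [← Real.exp_add, ← Real.exp_add]; congr 1; ring

end PSpin

/-! ### The mean ground state energy is bounded away from zero. -/

namespace PSpin

variable {p N : ℕ}

/-- Changing signs of entries preserves the law of a Gaussian tensor. -/
lemma measurePreserving_flip (T : Finset (Fin p → Fin N)) :
    MeasurePreserving (fun (A : Tensor p N) J => if J ∈ T then A J else -A J)
      (gaussianTensor p N) (gaussianTensor p N) := by
  classical
  refine measurePreserving_pi (α := fun _ : Fin p → Fin N => ℝ) (β := fun _ => ℝ)
    (f := fun J x => if J ∈ T then x else -x) _ _ fun J => ?_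
  by_cases hJ : J ∈ T
  · simp only [hJ, if_true]
    exact MeasurePreserving.id _
  · simp only [hJ, if_false]
    refine ⟨by fun_prop, ?_⟩
    rw [gaussianReal_map_neg, neg_zero]

/-- The local field on the site `i`, all other sites being taken from `I`. -/
lemma exists_sign_groundState_add_le (q N : ℕ) (I : Finset (Fin N)) (A : Tensor (q + 1) N) :
    groundState A + groundState (fun J => if J ∈ Fintype.piFinset
        (Fin.cons Iᶜ fun _ : Fin q => I : Fin (q + 1) → Finset (Fin N)) then A J else -A J) ≤
      -(2 / N) * ∑ i ∈ Iᶜ, |∑ J, (if J ∈ Fintype.piFinset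
        (Fin.cons {i} fun _ : Fin q => I : Fin (q + 1) → Finset (Fin N)) then 1 else 0) * A J| := by
  classical
  set T := Fintype.piFinset (Fin.cons Iᶜ fun _ : Fin q => I : Fin (q + 1) → Finset (Fin N))
  set h : Fin N → ℝ := fun i => ∑ J, (if J ∈ Fintype.piFinset
        (Fin.cons {i} fun _ : Fin q => I : Fin (q + 1) → Finset (Fin N)) then 1 else 0) * A J
  let σ : Vec N := WithLp.toLp 2 fun i => if i ∈ I then 1 else if 0 < h i then -1 else 1
  have hσ : σ ∈ binaryCube N := fun i => by
    simp only [σ]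
    split_ifs <;> simp
  have h1 := groundState_le A hσ
  have h2 := groundState_le (fun J => if J ∈ T then A J else -A J) hσ
  -- Outside the block `T` the two tensors are opposite and cancel. In the block all spins but the
  -- first are 1, so what remains is linear in the spins off `I`, each of which is set against its
  -- field.
  have hsum : A.form σ + Tensor.form (fun J => if J ∈ T then A J else -A J) σ =
      -2 * ∑ i ∈ Iᶜ, |h i| := by
    have e1 : ∀ J, A J * ∏ k, σ (J k) + (if J ∈ T then A J else -A J) * ∏ k, σ (J k) =
        ∑ i ∈ Iᶜ, 2 * (σ i * ((if J ∈ Fintype.piFinset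
        (Fin.cons {i} fun _ : Fin q => I : Fin (q + 1) → Finset (Fin N)) then 1 else 0) * A J)) := by
      intro J
      have hmem : ∀ S : Finset (Fin N), J ∈ Fintype.piFinset
          (Fin.cons S fun _ : Fin q => I : Fin (q + 1) → Finset (Fin N)) ↔
          J 0 ∈ S ∧ ∀ k : Fin q, J k.succ ∈ I := fun S => by
        rw [Fintype.mem_piFinset, Fin.forall_fin_succ]
        simp
      by_cases hJ : ∀ k : Fin q, J k.succ ∈ I
      · by_cases h0 : J 0 ∈ Iᶜ
        · have hT : J ∈ T := (hmem _).2 ⟨h0, hJ⟩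
          rw [if_pos hT, Fin.prod_univ_succ, Finset.sum_eq_single (J 0)]
          · rw [if_pos ((hmem _).2 ⟨by simp, hJ⟩)]
            have : ∏ k : Fin q, σ (J k.succ) = 1 := Finset.prod_eq_one fun k _ => by
              simp [σ, hJ k]
            rw [this]; ring
          · intro i _ hi
            rw [if_neg]; · ring
            rw [hmem]
            rintro ⟨h, -⟩
            exact hi (Finset.mem_singleton.1 h).symm
          · intro h; exact absurd h0 h
        · have hT : J ∉ T := fun h => h0 ((hmem _).1 h).1
          rw [if_neg hT, Finset.sum_eq_zero]
          · ring
          · intro i hi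
            rw [if_neg]; · ring
            rw [hmem]
            rintro ⟨h, -⟩
            exact h0 (Finset.mem_singleton.1 h ▸ hi)
      · have hT : J ∉ T := fun h => hJ ((hmem _).1 h).2
        rw [if_neg hT, Finset.sum_eq_zero]
        · ring
        · intro i hi
          rw [if_neg]; · ring
          rw [hmem]
          exact fun h => hJ h.2
    rw [Tensor.form, Tensor.form, ← Finset.sum_add_distrib, Finset.sum_congr rfl fun J _ => e1 J,
      Finset.sum_comm, Finset.mul_sum]
    refine Finset.sum_congr rfl fun i hi => ?_
    rw [← Finset.mul_sum, ← Finset.mul_sum]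
    change 2 * (σ i * h i) = -2 * |h i|
    have hi' : i ∉ I := Finset.mem_compl.1 hi
    simp only [σ, hi', if_false]
    split_ifs with hpos
    · rw [abs_of_pos hpos]; ring
    · rw [abs_of_nonpos (not_lt.1 hpos)]; ring
  calc _ ≤ _ := add_le_add h1 h2
    _ = (A.form σ + Tensor.form (fun J => if J ∈ T then A J else -A J) σ) / N := by rw [add_div]
    _ = _ := by rw [hsum]; ring

/-- Flipping the signs off the block preserves the law, so the average of
`exists_sign_groundState_add_le` bounds twice the mean ground state energy. With `I` about half of
the sites, there are order $N$ fields, each with mean absolute value of order one. -/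
lemma exists_integral_groundState_le (hp : 0 < p) : ∃ c₀ : ℝ, 0 < c₀ ∧ ∀ N : ℕ, 2 ≤ N →
    ∫ A, groundState A ∂(gaussianTensor p N) ≤ -c₀ := by
  classical
  obtain ⟨q, rfl⟩ : ∃ q, p = q + 1 := ⟨p - 1, by omega⟩
  set κ₀ := ∫ x, |x| ∂(gaussianReal 0 1) with hκ
  have hκ0 : 0 < κ₀ := integral_abs_gaussianReal_pos
  refine ⟨1 / 3 * (√((1 / 3) ^ q) * κ₀), by positivity, fun N hN => ?_⟩
  have hNr : (0 : ℝ) < N := by exact_mod_cast (by omega : 0 < N)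
  set I : Finset (Fin N) := Finset.univ.filter fun i => i.val < N / 2 with hI
  have hIc : I.card = N / 2 := by
    rw [hI, Fin.card_filter_val_lt]
    omega
  have hIcc : Iᶜ.card = N - N / 2 := by
    rw [Finset.card_compl, hIc, Fintype.card_fin]
  have h3 : (N : ℝ) / 3 ≤ (N / 2 : ℕ) := by
    rw [div_le_iff₀ (by norm_num)]
    exact_mod_cast (by omega : N ≤ N / 2 * 3)
  have h3' : (N : ℝ) / 3 ≤ (N - N / 2 : ℕ) := by
    rw [div_le_iff₀ (by norm_num)]
    exact_mod_cast (by omega : N ≤ (N - N / 2) * 3)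
  set γ := gaussianTensor (q + 1) N
  set w : Fin N → (Fin (q + 1) → Fin N) → ℝ := fun i J => if J ∈ Fintype.piFinset
        (Fin.cons {i} fun _ : Fin q => I : Fin (q + 1) → Finset (Fin N)) then 1 else 0 with hw
  set φ : Tensor (q + 1) N → Tensor (q + 1) N := fun A J => if J ∈ Fintype.piFinset
        (Fin.cons Iᶜ fun _ : Fin q => I : Fin (q + 1) → Finset (Fin N)) then A J else -A J
  have hφ : MeasurePreserving φ γ γ := measurePreserving_flip _
  have hint : Integrable groundState γ := integrable_groundState
  have hint2 : Integrable (fun A => groundState (φ A)) γ := hφ.integrable_comp_of_integrable hint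
  have hφint : ∫ A, groundState (φ A) ∂γ = ∫ A, groundState A ∂γ := by
    conv_rhs => rw [← hφ.map_eq]
    rw [integral_map hφ.measurable.aemeasurable continuous_groundState.aestronglyMeasurable]
  have hwint : ∀ i, Integrable (fun A : Tensor (q + 1) N => |∑ J, w i J * A J|) γ := fun i =>
    (HasSubgaussianMGF.integrable (hasSubgaussianMGF_sum_gaussianPi _ (w i))).abs
  have hle : ∫ A, (groundState A + groundState (φ A)) ∂γ ≤
      ∫ A : Tensor (q + 1) N, -(2 / N) * ∑ i ∈ Iᶜ, |∑ J, w i J * A J| ∂γ :=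
    integral_mono (hint.add hint2)
      ((integrable_finsetSum _ fun i _ => hwint i).const_mul _)
      fun A => exists_sign_groundState_add_le q N I A
  rw [integral_add hint hint2, hφint, integral_const_mul,
    integral_finsetSum _ fun i _ => hwint i] at hle
  have hval : ∀ i, √((1 / 3) ^ q) * κ₀ ≤ ∫ A : Tensor (q + 1) N, |∑ J, w i J * A J| ∂γ := by
    intro i
    rw [show γ = _ from gaussianTensor_eq (q + 1) N, integral_abs_sum_gaussianPi]
    gcongr
    have : ∑ J, w i J ^ 2 = ((N / 2 : ℕ) : ℝ) ^ q := by
      have e : ∀ J, w i J ^ 2 = w i J := fun J => by simp only [hw]; split_ifs <;> norm_num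
      simp_rw [e, hw]
      rw [Finset.sum_ite_mem, Finset.univ_inter, Finset.sum_const, Fintype.card_piFinset,
        Fin.prod_univ_succ]
      simp [hIc]
    rw [this]
    push_cast
    rw [inv_mul_eq_div, ← div_pow]
    refine pow_le_pow_left₀ (by norm_num) ?_ _
    rw [le_div_iff₀ hNr]
    linarith
  have hsum : (N - N / 2 : ℕ) * (√((1 / 3) ^ q) * κ₀) ≤
      ∑ i ∈ Iᶜ, ∫ A : Tensor (q + 1) N, |∑ J, w i J * A J| ∂γ := by
    rw [← hIcc, ← nsmul_eq_mul]
    exact Finset.card_nsmul_le_sum _ _ _ fun i _ => hval i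
  have h4 : (N : ℝ) / 3 * (√((1 / 3) ^ q) * κ₀) ≤
      ∑ i ∈ Iᶜ, ∫ A : Tensor (q + 1) N, |∑ J, w i J * A J| ∂γ :=
    le_trans (by gcongr) hsum
  have h5 := mul_le_mul_of_nonneg_left h4 (by positivity : (0 : ℝ) ≤ 2 / N)
  have h6 : (2 : ℝ) / N * (N / 3 * (√((1 / 3) ^ q) * κ₀)) = 2 * (1 / 3 * (√((1 / 3) ^ q) * κ₀)) := by
    field_simp
  linarith

end PSpin

/-! ### Stability of the iteration under perturbation of the tensor. -/

namespace PSpin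

variable {p r N : ℕ}

lemma abs_tanh_sub_le (x y : ℝ) : |Real.tanh x - Real.tanh y| ≤ |x - y| := by
  have hd : ∀ z : ℝ, HasDerivAt Real.tanh (1 / Real.cosh z ^ 2) z := fun z => by
    have h := (Real.hasDerivAt_sinh z).div (Real.hasDerivAt_cosh z) (Real.cosh_pos z).ne'
    have e : Real.tanh = Real.sinh / Real.cosh := by
      ext w; rw [Pi.div_apply, Real.tanh_eq_sinh_div_cosh]
    have e2 : 1 / Real.cosh z ^ 2 =
        (Real.cosh z * Real.cosh z - Real.sinh z * Real.sinh z) / Real.cosh z ^ 2 := by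
      congr 1; linarith [Real.cosh_sq_sub_sinh_sq z]
    rw [e, e2]
    exact h
  have := Convex.norm_image_sub_le_of_norm_hasDerivWithin_le (f := Real.tanh) (C := 1)
    (s := Set.univ) (fun z _ => (hd z).hasDerivWithinAt) (fun z _ => by
      rw [Real.norm_of_nonneg (by positivity), div_le_one (by have := Real.cosh_pos z; positivity)]
      exact one_le_pow₀ (Real.one_le_cosh z)) convex_univ (Set.mem_univ y) (Set.mem_univ x)
  simpa using this

lemma norm_le_norm_of_forall_abs_le {x y : Vec N} (h : ∀ i, |x i| ≤ |y i|) : ‖x‖ ≤ ‖y‖ := by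
  rw [EuclideanSpace.norm_eq, EuclideanSpace.norm_eq]
  gcongr with i
  exact h i

lemma norm_trunc_sub_le (M : ℝ) (x y : Vec N) : ‖trunc M x - trunc M y‖ ≤ ‖x - y‖ := by
  refine norm_le_norm_of_forall_abs_le fun i => ?_
  simp only [trunc, PiLp.sub_apply]
  rw [max_comm, max_comm (-M)]
  refine (abs_max_sub_max_le_abs _ _ _).trans ?_
  have := abs_min_sub_min_le_max (x i) M (y i) M
  simpa using this

lemma norm_vecTanh_sub_le (x y : Vec N) : ‖vecTanh x - vecTanh y‖ ≤ ‖x - y‖ :=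
  norm_le_norm_of_forall_abs_le fun i => by
    simpa [vecTanh] using abs_tanh_sub_le (x i) (y i)

lemma norm_le_mul_sqrt {x : Vec N} {R : ℝ} (hR : 0 ≤ R) (h : ∀ i, |x i| ≤ R) :
    ‖x‖ ≤ R * √N := by
  rw [EuclideanSpace.norm_eq]
  calc √(∑ i, ‖x i‖ ^ 2) ≤ √(∑ _i : Fin N, R ^ 2) := by
        gcongr with i
        exact h i
    _ = R * √N := by
        rw [Finset.sum_const, Finset.card_univ, Fintype.card_fin, nsmul_eq_mul, mul_comm,
          Real.sqrt_mul (by positivity), Real.sqrt_sq hR]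

lemma trunc_mem_cube (x : Vec N) : trunc 1 x ∈ cube N := fun i => by
  simp only [trunc, Set.mem_Icc]
  exact ⟨le_max_left _ _, max_le (by norm_num) (min_le_right _ _)⟩

lemma norm_le_sqrt_of_mem_cube {x : Vec N} (hx : x ∈ cube N) : ‖x‖ ≤ √N := by
  simpa using norm_le_mul_sqrt zero_le_one fun i => abs_le.2 (hx i)

/-- By this duality a bound on the injective norm controls the Euclidean norm of the marginal. -/
lemma inner_marginal (A : Tensor (r + 1) N) (w u : Vec N) :
    inner ℝ w (A.marginal u) = A.multiform (Fin.cons w fun _ => u) := by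
  have e : ∀ J : Fin (r + 1) → Fin N, ∏ k, (Fin.cons w fun _ => u : Fin (r + 1) → Vec N) k (J k) =
      w (J 0) * ∏ k : Fin (r + 1) with k.val ≠ 0, u (J k) := fun J => by
    rw [Fin.prod_univ_succ, Finset.prod_filter, Fin.prod_univ_succ]
    simp
  rw [multiform_apply, PiLp.inner_apply]
  simp only [Tensor.marginal, RCLike.inner_apply, conj_trivial, Finset.sum_mul, Finset.sum_filter]
  rw [Finset.sum_comm]
  refine Finset.sum_congr rfl fun J _ => ?_
  have hc : ∀ i, (∀ k : Fin (r + 1), k.val = 0 → J k = i) ↔ J 0 = i := fun i =>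
    ⟨fun h => h 0 rfl, fun h k hk => by rwa [Fin.ext (b := 0) hk]⟩
  simp_rw [hc, ite_mul, zero_mul]
  rw [Finset.sum_ite_eq, if_pos (Finset.mem_univ _), e]
  ring

lemma norm_le_of_inner_le {x : Vec N} {b : ℝ} (hb : 0 ≤ b) (h : inner ℝ x x ≤ b * ‖x‖) :
    ‖x‖ ≤ b := by
  rw [real_inner_self_eq_norm_sq, pow_two] at h
  by_contra hcon
  have : 0 < ‖x‖ := hb.trans_lt (not_le.1 hcon)
  nlinarith

lemma norm_marginal_le {A : Tensor (r + 1) N} {d R : ℝ} (hN : 0 < N) (hA : InjBound A d)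
    (hd : 0 ≤ d) (hR : 0 ≤ R) {u : Vec N} (hu : ‖u‖ ≤ R * √N) :
    ‖A.marginal u‖ ≤ d * R ^ r * √N := by
  have hNr : (0 : ℝ) < N := by exact_mod_cast hN
  refine norm_le_of_inner_le (by positivity) ?_
  rw [inner_marginal]
  refine (le_abs_self _).trans ((hA _).trans ?_)
  rw [Fin.prod_univ_succ]
  simp only [Fin.cons_zero, Fin.cons_succ, Finset.prod_const, Finset.card_univ, Fintype.card_fin]
  have h1 : ‖u‖ / √N ≤ R := by rw [div_le_iff₀ (by positivity)]; exact hu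
  calc d * N * (‖A.marginal u‖ / √N * (‖u‖ / √N) ^ r)
      ≤ d * N * (‖A.marginal u‖ / √N * R ^ r) := by gcongr
    _ = d * (√N * √N) * (‖A.marginal u‖ / √N * R ^ r) := by rw [Real.mul_self_sqrt hNr.le]
    _ = _ := by field_simp

lemma norm_marginal_sub_le {A : Tensor (r + 1) N} {C R : ℝ} (hr : 0 < r) (hN : 0 < N)
    (hA : InjBound A C) (hC : 0 ≤ C) (hR : 0 ≤ R) {u u' : Vec N} (hu : ‖u‖ ≤ R * √N)
    (hu' : ‖u'‖ ≤ R * √N) :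
    ‖A.marginal u - A.marginal u'‖ ≤ C * r * R ^ (r - 1) * ‖u - u'‖ := by
  have hNr : (0 : ℝ) < N := by exact_mod_cast hN
  have hs : (0 : ℝ) < √N := by positivity
  set D := A.marginal u - A.marginal u' with hD
  refine norm_le_of_inner_le (by positivity) ?_
  conv_lhs => rw [hD, inner_sub_right, inner_marginal, inner_marginal]
  rw [← hD]
  have hb := (A.multiform.curryLeft D).norm_image_sub_le_of_bound
    (C := C * N / √N ^ (r + 1) * ‖D‖) (by positivity) (fun m => by
      rw [MultilinearMap.curryLeft_apply]
      refine (hA _).trans_eq ?_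
      rw [Fin.prod_univ_succ]
      simp only [Fin.cons_zero, Fin.cons_succ, Finset.prod_div_distrib, Finset.prod_const,
        Finset.card_univ, Fintype.card_fin]
      field_simp
      ring) (fun _ => u) (fun _ => u')
  rw [MultilinearMap.curryLeft_apply, MultilinearMap.curryLeft_apply, Fintype.card_fin] at hb
  refine (le_abs_self _).trans (hb.trans ?_)
  have h1 : max ‖(fun _ : Fin r => u)‖ ‖(fun _ : Fin r => u')‖ ≤ R * √N :=
    max_le ((pi_norm_const_le u).trans hu) ((pi_norm_const_le u').trans hu')
  have h2 : ‖(fun _ : Fin r => u) - (fun _ : Fin r => u')‖ ≤ ‖u - u'‖ :=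
    pi_norm_const_le (u - u')
  calc _ ≤ C * N / √N ^ (r + 1) * ‖D‖ * r * (R * √N) ^ (r - 1) * ‖u - u'‖ := by gcongr
    _ = _ := by
      obtain ⟨s, rfl⟩ : ∃ s, r = s + 1 := ⟨r - 1, by omega⟩
      rw [add_tsub_cancel_right, mul_pow]
      have e : √(N : ℝ) ^ (s + 1 + 1) = √N ^ s * N := by
        rw [pow_succ, pow_succ, mul_assoc, Real.mul_self_sqrt hNr.le]
      rw [e]
      field_simp

lemma marginal_sub (A B : Tensor p N) (u : Vec N) :
    (A - B).marginal u = A.marginal u - B.marginal u := by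
  ext i
  simp [Tensor.marginal, sub_mul]

lemma continuous_marginal : Continuous fun z : Tensor p N × Vec N => z.1.marginal z.2 := by
  unfold Tensor.marginal
  fun_prop

lemma continuous_form : Continuous fun z : Tensor p N × Vec N => z.1.form z.2 := by
  unfold Tensor.form
  fun_prop

lemma continuous_trunc (M : ℝ) : Continuous (trunc M : Vec N → Vec N) := by
  unfold trunc
  fun_prop

lemma continuous_vecTanh : Continuous (vecTanh : Vec N → Vec N) :=
  (LipschitzWith.of_dist_le_mul (K := 1) fun x y => by
    simpa [dist_eq_norm] using norm_vecTanh_sub_le x y).continuous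

lemma continuous_tapIterate (β M q : ℝ) (a : ℕ → ℝ) (t : ℕ) :
    Continuous fun A : Tensor p N => tapIterate A β M q a t := by
  induction t using Nat.twoStepInduction with
  | zero => simp only [tapIterate]; exact continuous_const
  | one =>
    simp only [tapIterate]
    exact (continuous_trunc M).comp (continuous_vecTanh.comp
      ((continuous_marginal.comp (continuous_id.prodMk continuous_const)).const_smul β))
  | more t h0 h1 =>
    simp only [tapIterate]
    exact (continuous_trunc M).comp (continuous_vecTanh.comp
      (((continuous_marginal.comp (continuous_id.prodMk h1)).const_smul β).add ((continuous_const (y := a t)).smul h0)))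

lemma continuous_tapOutput (β M q : ℝ) (a : ℕ → ℝ) (T : ℕ) :
    Continuous fun A : Tensor p N => tapOutput A β M q a T :=
  (continuous_trunc 1).comp (continuous_tapIterate β M q a T)

lemma abs_trunc_vecTanh_le (M : ℝ) (hM : 0 < M) (x : Vec N) (i : Fin N) :
    |trunc M (vecTanh x) i| ≤ 1 := by
  have h := abs_lt.1 (Real.abs_tanh_lt_one (x i))
  simp only [trunc, vecTanh]
  rw [abs_le]
  refine ⟨?_, max_le (by linarith) ((min_le_left _ _).trans h.2.le)⟩
  rcases le_total (Real.tanh (x i)) M with h' | h'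
  · rw [min_eq_left h']; exact h.1.le.trans (le_max_right _ _)
  · rw [min_eq_right h']; exact (by linarith : (-1 : ℝ) ≤ M).trans (le_max_right _ _)

lemma norm_tapIterate_le (A : Tensor p N) (β : ℝ) {M q : ℝ} (hM : 0 < M) (hq : 0 < q) (a : ℕ → ℝ)
    (t : ℕ) : ‖tapIterate A β M q a t‖ ≤ max 1 q * √N := by
  have hR : (0 : ℝ) ≤ max 1 q := zero_le_one.trans (le_max_left _ _)
  refine norm_le_mul_sqrt hR fun i => ?_
  match t with
  | 0 => simp [tapIterate, abs_of_pos hq]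
  | 1 => exact (abs_trunc_vecTanh_le M hM _ i).trans (le_max_left _ _)
  | t + 2 => exact (abs_trunc_vecTanh_le M hM _ i).trans (le_max_left _ _)

lemma norm_sub_trunc_vecTanh_le (M : ℝ) (x y : Vec N) :
    ‖trunc M (vecTanh x) - trunc M (vecTanh y)‖ ≤ ‖x - y‖ :=
  (norm_trunc_sub_le _ _ _).trans (norm_vecTanh_sub_le _ _)

/-- The iterates are Lipschitz functions of the tensor with respect to the injective norm. -/
lemma exists_norm_tapIterate_sub_le (hr : 0 < r) (β : ℝ) {M q C : ℝ} (hM : 0 < M) (hq : 0 < q)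
    (hC : 0 ≤ C) (a : ℕ → ℝ) (t : ℕ) : ∃ L : ℝ, 0 ≤ L ∧ ∀ N : ℕ, 0 < N →
      ∀ A B : Tensor (r + 1) N, ∀ d : ℝ, 0 ≤ d → InjBound A C → InjBound (A - B) d →
        ‖tapIterate A β M q a t - tapIterate B β M q a t‖ ≤ L * d * √N := by
  set R := max 1 q with hRdef
  have hR : 0 ≤ R := zero_le_one.trans (le_max_left _ _)
  have hstep : ∀ N : ℕ, 0 < N → ∀ A B : Tensor (r + 1) N, ∀ d : ℝ, 0 ≤ d → InjBound A C →
      InjBound (A - B) d → ∀ t L, ‖tapIterate A β M q a t - tapIterate B β M q a t‖ ≤ L * d * √N →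
      ‖A.marginal (tapIterate A β M q a t) - B.marginal (tapIterate B β M q a t)‖ ≤
        (C * r * R ^ (r - 1) * L + R ^ r) * d * √N := by
    intro N hN A B d hd hA hAB t L hL
    set u := tapIterate A β M q a t
    set u' := tapIterate B β M q a t
    have hu : ‖u‖ ≤ R * √N := norm_tapIterate_le A β hM hq a t
    have hu' : ‖u'‖ ≤ R * √N := norm_tapIterate_le B β hM hq a t
    -- The first difference uses the injective norm of `A` and the previous iterates, the second
    -- that of `A - B`; no bound on `B` itself is needed.
    have e : A.marginal u - B.marginal u' =
        (A.marginal u - A.marginal u') + (A - B).marginal u' := by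
      rw [marginal_sub]; abel
    rw [e]
    have h1 := norm_marginal_sub_le hr hN hA hC hR hu hu'
    have h2 := norm_marginal_le hN hAB hd hR hu'
    have h3 : C * r * R ^ (r - 1) * ‖u - u'‖ ≤ C * r * R ^ (r - 1) * (L * d * √N) := by gcongr
    calc _ ≤ _ := norm_add_le _ _
      _ ≤ C * r * R ^ (r - 1) * (L * d * √N) + d * R ^ r * √N := by linarith
      _ = _ := by ring
  induction t using Nat.twoStepInduction with
  | zero => exact ⟨0, le_rfl, fun N hN A B d hd hA hAB => by simp [tapIterate]⟩
  | one =>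
    refine ⟨|β| * (C * r * R ^ (r - 1) * 0 + R ^ r), by positivity,
      fun N hN A B d hd hA hAB => ?_⟩
    simp only [tapIterate]
    refine (norm_sub_trunc_vecTanh_le _ _ _).trans ?_
    rw [← smul_sub, norm_smul, Real.norm_eq_abs, mul_assoc, mul_assoc |β|, ← mul_assoc _ d]
    gcongr
    exact hstep N hN A B d hd hA hAB 0 0 (by simp [tapIterate])
  | more t h0 h1 =>
    obtain ⟨L0, hL0, h0⟩ := h0
    obtain ⟨L1, hL1, h1⟩ := h1
    refine ⟨|β| * (C * r * R ^ (r - 1) * L1 + R ^ r) + |a t| * L0, by positivity,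
      fun N hN A B d hd hA hAB => ?_⟩
    have k1 := hstep N hN A B d hd hA hAB (t + 1) L1 (h1 N hN A B d hd hA hAB)
    have k0 := h0 N hN A B d hd hA hAB
    simp only [tapIterate]
    refine (norm_sub_trunc_vecTanh_le _ _ _).trans ?_
    rw [add_sub_add_comm, ← smul_sub, ← smul_sub]
    refine (norm_add_le _ _).trans ?_
    rw [norm_smul, norm_smul, Real.norm_eq_abs, Real.norm_eq_abs]
    have k1' := mul_le_mul_of_nonneg_left k1 (abs_nonneg β)
    have k0' := mul_le_mul_of_nonneg_left k0 (abs_nonneg (a t))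
    calc _ ≤ _ := add_le_add k1' k0'
      _ = _ := by ring

lemma exists_norm_tapOutput_sub_le (hr : 0 < r) (β : ℝ) {M q C : ℝ} (hM : 0 < M) (hq : 0 < q)
    (hC : 0 ≤ C) (a : ℕ → ℝ) (T : ℕ) : ∃ L : ℝ, 0 ≤ L ∧ ∀ N : ℕ, 0 < N →
      ∀ A B : Tensor (r + 1) N, ∀ d : ℝ, 0 ≤ d → InjBound A C → InjBound (A - B) d →
        ‖tapOutput A β M q a T - tapOutput B β M q a T‖ ≤ L * d * √N := by
  obtain ⟨L, hL, h⟩ := exists_norm_tapIterate_sub_le hr β hM hq hC a T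
  exact ⟨L, hL, fun N hN A B d hd hA hAB =>
    (norm_trunc_sub_le _ _ _).trans (h N hN A B d hd hA hAB)⟩

end PSpin

/-! ### The Ornstein–Uhlenbeck chain and its probability of staying in a set. -/

namespace PSpin

section OUChain

variable {ι : Type*}

/-- The Ornstein–Uhlenbeck chain started at `ω 0` and driven by `ω 1, ω 2, …`. -/
noncomputable def chain (ρ : ℝ) (ω : ℕ → ι → ℝ) : ℕ → ι → ℝ
  | 0 => ω 0
  | n + 1 => ρ • chain ρ ω n + √(1 - ρ ^ 2) • ω (n + 1)

/-- The normalised part of the chain that is independent of its starting point. -/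
noncomputable def freshPart (ρ : ℝ) (ω : ℕ → ι → ℝ) : ℕ → ι → ℝ
  | 0 => 0
  | n + 1 => (ρ * √(1 - ρ ^ (2 * n)) / √(1 - ρ ^ (2 * (n + 1)))) • freshPart ρ ω n +
      (√(1 - ρ ^ 2) / √(1 - ρ ^ (2 * (n + 1)))) • ω (n + 1)

lemma one_sub_pow_pos {ρ : ℝ} (h0 : 0 ≤ ρ) (h1 : ρ < 1) (n : ℕ) :
    0 < 1 - ρ ^ (2 * (n + 1)) := by
  have := pow_lt_one₀ h0 h1 (n := 2 * (n + 1)) (by omega)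
  linarith

lemma chain_eq {ρ : ℝ} (h0 : 0 ≤ ρ) (h1 : ρ < 1) (ω : ℕ → ι → ℝ) (n : ℕ) :
    chain ρ ω n = ρ ^ n • ω 0 + √(1 - ρ ^ (2 * n)) • freshPart ρ ω n := by
  induction n with
  | zero => simp [chain]
  | succ n ih =>
    have hs : √(1 - ρ ^ (2 * (n + 1))) ≠ 0 := (Real.sqrt_pos.2 (one_sub_pow_pos h0 h1 n)).ne'
    rw [chain, ih, freshPart]
    ext i
    simp only [Pi.add_apply, Pi.smul_apply, smul_eq_mul]
    field_simp
    ring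

lemma measurable_chain (ρ : ℝ) (n : ℕ) : Measurable fun ω : ℕ → ι → ℝ => chain ρ ω n := by
  induction n with
  | zero => simp only [chain]; fun_prop
  | succ n ih => simp only [chain]; fun_prop

lemma measurable_freshPart (ρ : ℝ) (n : ℕ) : Measurable fun ω : ℕ → ι → ℝ => freshPart ρ ω n := by
  induction n with
  | zero => simp only [freshPart]; fun_prop
  | succ n ih => simp only [freshPart]; fun_prop

lemma chain_congr (ρ : ℝ) {ω ω' : ℕ → ι → ℝ} {n : ℕ} (h : ∀ k ≤ n, ω k = ω' k) :
    chain ρ ω n = chain ρ ω' n := by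
  induction n with
  | zero => exact h 0 le_rfl
  | succ n ih => rw [chain, chain, ih fun k hk => h k (by omega), h (n + 1) le_rfl]

lemma freshPart_congr (ρ : ℝ) {ω ω' : ℕ → ι → ℝ} {n : ℕ} (h : ∀ k ≤ n, ω k = ω' k) :
    freshPart ρ ω n = freshPart ρ ω' n := by
  induction n with
  | zero => rfl
  | succ n ih => rw [freshPart, freshPart, ih fun k hk => h k (by omega), h (n + 1) le_rfl]

end OUChain

section Chain

open scoped ENNReal

variable {ι : Type*} [Fintype ι]

/-- The Ornstein–Uhlenbeck operator with correlation `ρ`. -/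
noncomputable def ouOperator (v : ℝ≥0) (ρ : ℝ) (f : (ι → ℝ) → ℝ≥0∞) (x : ι → ℝ) : ℝ≥0∞ :=
  ∫⁻ z, f (ρ • x + √(1 - ρ ^ 2) • z) ∂(gaussianPi ι v)

lemma measurable_ouOperator (v : ℝ≥0) (ρ : ℝ) {f : (ι → ℝ) → ℝ≥0∞} (hf : Measurable f) :
    Measurable (ouOperator v ρ f) := by
  have : Measurable fun q : (ι → ℝ) × (ι → ℝ) => f (ρ • q.1 + √(1 - ρ ^ 2) • q.2) :=
    hf.comp (by fun_prop)
  exact this.lintegral_prod_right'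

lemma sq_add_sq_sqrt {ρ : ℝ} (h0 : 0 ≤ ρ) (h1 : ρ ≤ 1) : ρ ^ 2 + √(1 - ρ ^ 2) ^ 2 = 1 := by
  rw [Real.sq_sqrt (by nlinarith)]; ring

/-- The Ornstein–Uhlenbeck operator is self-adjoint. -/
lemma lintegral_mul_ouOperator (v : ℝ≥0) {ρ : ℝ} (h0 : 0 ≤ ρ) (h1 : ρ ≤ 1)
    {f g : (ι → ℝ) → ℝ≥0∞} (hf : Measurable f) (hg : Measurable g) :
    ∫⁻ x, f x * ouOperator v ρ g x ∂(gaussianPi ι v) =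
      ∫⁻ x, ouOperator v ρ f x * g x ∂(gaussianPi ι v) := by
  have hR := measurePreserving_reflection (ι := ι) v (sq_add_sq_sqrt h0 h1)
  set σ := √(1 - ρ ^ 2) with hσ
  have hF : ∀ f g : (ι → ℝ) → ℝ≥0∞, Measurable f → Measurable g →
      ∫⁻ x, f x * ouOperator v ρ g x ∂(gaussianPi ι v) =
        ∫⁻ q, f q.1 * g (ρ • q.1 + σ • q.2) ∂((gaussianPi ι v).prod (gaussianPi ι v)) := by
    intro f g hf hg
    have hm : Measurable fun q : (ι → ℝ) × (ι → ℝ) => f q.1 * g (ρ • q.1 + σ • q.2) :=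
      (hf.comp measurable_fst).mul (hg.comp (by fun_prop))
    rw [lintegral_prod _ hm.aemeasurable]
    refine lintegral_congr fun x => ?_
    have hm' : Measurable fun z => g (ρ • x + σ • z) := hg.comp (by fun_prop)
    exact (lintegral_const_mul _ hm').symm
  have hm : Measurable fun q : (ι → ℝ) × (ι → ℝ) => f q.1 * g (ρ • q.1 + σ • q.2) :=
    (hf.comp measurable_fst).mul (hg.comp (by fun_prop))
  simp_rw [mul_comm (ouOperator v ρ f _)]
  rw [hF f g hf hg, hF g f hg hf, ← hR.lintegral_comp hm]
  refine lintegral_congr fun q => ?_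
  -- The reflection is an involution that exchanges the present and the next state; this is the
  -- reversibility of the chain.
  have : ρ • (ρ • q.1 + σ • q.2) + σ • (σ • q.1 - ρ • q.2) = q.1 := by
    have h := sq_add_sq_sqrt h0 h1
    rw [← hσ] at h
    ext i
    simp only [Pi.add_apply, Pi.smul_apply, Pi.sub_apply, smul_eq_mul]
    linear_combination q.1 i * h
  rw [this, mul_comm]

lemma lintegral_ouOperator (v : ℝ≥0) {ρ : ℝ} (h0 : 0 ≤ ρ) (h1 : ρ ≤ 1)
    {f : (ι → ℝ) → ℝ≥0∞} (hf : Measurable f) :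
    ∫⁻ x, ouOperator v ρ f x ∂(gaussianPi ι v) = ∫⁻ x, f x ∂(gaussianPi ι v) := by
  have := lintegral_mul_ouOperator v h0 h1 (f := fun _ => 1) measurable_const hf
  simpa [ouOperator] using this

/-- The semigroup property: the two noises combine into one Gaussian vector. It exhibits the
operator as the square of a self-adjoint one, which gives the positivity behind the one-step bound.
-/
lemma ouOperator_sqrt_sqrt (v : ℝ≥0) {ρ : ℝ} (h0 : 0 ≤ ρ) (h1 : ρ < 1)
    {f : (ι → ℝ) → ℝ≥0∞} (hf : Measurable f) (x : ι → ℝ) :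
    ouOperator v (√ρ) (ouOperator v (√ρ) f) x = ouOperator v ρ f x := by
  set σ := √(1 - ρ ^ 2) with hσ
  have hσ2 : σ ^ 2 = 1 - ρ ^ 2 := Real.sq_sqrt (by nlinarith)
  have hσ0 : 0 < σ := Real.sqrt_pos.2 (by nlinarith)
  have hr2 : √ρ ^ 2 = ρ := Real.sq_sqrt h0
  set s := √(1 - √ρ ^ 2) with hs
  have hs2 : s ^ 2 = 1 - ρ := by rw [hs, hr2]; exact Real.sq_sqrt (by linarith)
  have hab : (√ρ * s / σ) ^ 2 + (s / σ) ^ 2 = 1 := by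
    rw [div_pow, div_pow, mul_pow, hr2, hs2, hσ2]
    have : 1 - ρ ^ 2 ≠ 0 := by nlinarith
    field_simp
    ring
  have hc := measurePreserving_combination (ι := ι) v hab
  have hm : Measurable fun y : ι → ℝ => f (ρ • x + σ • y) := hf.comp (by fun_prop)
  have e : ouOperator v ρ f x = ∫⁻ y, f (ρ • x + σ • y) ∂(gaussianPi ι v) := rfl
  have hm' : Measurable fun q : (ι → ℝ) × (ι → ℝ) =>
      f (ρ • x + σ • ((√ρ * s / σ) • q.1 + (s / σ) • q.2)) := hm.comp hc.measurable
  rw [e, ← hc.lintegral_comp hm, lintegral_prod _ hm'.aemeasurable]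
  simp only [ouOperator]
  refine lintegral_congr fun z => lintegral_congr fun z' => ?_
  congr 1
  ext i
  simp only [Pi.add_apply, Pi.smul_apply, smul_eq_mul, ← hs]
  field_simp
  linear_combination x i * hr2

lemma sq_lintegral_le {Ω : Type*} [MeasurableSpace Ω] (μ : Measure Ω) [IsProbabilityMeasure μ]
    {f : Ω → ℝ≥0∞} (hf : Measurable f) : (∫⁻ x, f x ∂μ) ^ 2 ≤ ∫⁻ x, f x * f x ∂μ := by
  have h := ENNReal.lintegral_mul_le_Lp_mul_Lq μ Real.HolderConjugate.two_two
    hf.aemeasurable (g := fun _ => 1) aemeasurable_const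
  simp only [Pi.mul_apply, mul_one, ENNReal.one_rpow, lintegral_const, measure_univ] at h
  have h2 := pow_le_pow_left' h 2
  rw [← ENNReal.rpow_natCast (_ ^ (1 / 2 : ℝ)), ← ENNReal.rpow_mul] at h2
  norm_num at h2
  simpa [pow_two] using h2

/-- The Ornstein–Uhlenbeck operator killed outside a set. -/
noncomputable def killedOperator (v : ℝ≥0) (ρ : ℝ) (S : Set (ι → ℝ)) (f : (ι → ℝ) → ℝ≥0∞)
    (x : ι → ℝ) : ℝ≥0∞ :=
  S.indicator 1 x * ouOperator v ρ (fun y => S.indicator 1 y * f y) x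

lemma measurable_killedOperator (v : ℝ≥0) (ρ : ℝ) {S : Set (ι → ℝ)} (hS : MeasurableSet S)
    {f : (ι → ℝ) → ℝ≥0∞} (hf : Measurable f) : Measurable (killedOperator v ρ S f) :=
  (measurable_one.indicator hS).mul
    (measurable_ouOperator v ρ ((measurable_one.indicator hS).mul hf))

lemma measurable_iterate_killedOperator (v : ℝ≥0) (ρ : ℝ) {S : Set (ι → ℝ)}
    (hS : MeasurableSet S) {f : (ι → ℝ) → ℝ≥0∞} (hf : Measurable f) (n : ℕ) :
    Measurable ((killedOperator v ρ S)^[n] f) := by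
  induction n with
  | zero => exact hf
  | succ n ih =>
    rw [Function.iterate_succ_apply']
    exact measurable_killedOperator v ρ hS ih

lemma lintegral_mul_killedOperator (v : ℝ≥0) {ρ : ℝ} (h0 : 0 ≤ ρ) (h1 : ρ ≤ 1)
    {S : Set (ι → ℝ)} (hS : MeasurableSet S) {f g : (ι → ℝ) → ℝ≥0∞} (hf : Measurable f)
    (hg : Measurable g) :
    ∫⁻ x, f x * killedOperator v ρ S g x ∂(gaussianPi ι v) =
      ∫⁻ x, killedOperator v ρ S f x * g x ∂(gaussianPi ι v) := by
  have hind : Measurable (S.indicator (1 : (ι → ℝ) → ℝ≥0∞)) := measurable_one.indicator hS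
  have := lintegral_mul_ouOperator v h0 h1 (hind.mul hf) (hind.mul hg)
  simp only [Pi.mul_apply] at this
  calc _ = ∫⁻ x, S.indicator 1 x * f x * ouOperator v ρ (fun y => S.indicator 1 y * g y) x
        ∂(gaussianPi ι v) := lintegral_congr fun x => by rw [killedOperator]; ring
    _ = _ := this
    _ = _ := lintegral_congr fun x => by rw [killedOperator]; simp only [Pi.mul_def]; ring

lemma lintegral_iterate_killedOperator (v : ℝ≥0) {ρ : ℝ} (h0 : 0 ≤ ρ) (h1 : ρ ≤ 1)
    {S : Set (ι → ℝ)} (hS : MeasurableSet S) (n : ℕ) :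
    ∀ {f g : (ι → ℝ) → ℝ≥0∞}, Measurable f → Measurable g →
    ∫⁻ x, f x * (killedOperator v ρ S)^[n] g x ∂(gaussianPi ι v) =
      ∫⁻ x, (killedOperator v ρ S)^[n] f x * g x ∂(gaussianPi ι v) := by
  induction n with
  | zero => intros; rfl
  | succ n ih =>
    intro f g hf hg
    rw [Function.iterate_succ_apply', lintegral_mul_killedOperator v h0 h1 hS hf
      (measurable_iterate_killedOperator v ρ hS hg n), Function.iterate_succ_apply,
      ih (measurable_killedOperator v ρ hS hf) hg]

/-- Lower bound on the probability that the stationary chain stays in a set. -/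
lemma pow_measure_le_lintegral_iterate (v : ℝ≥0) {ρ : ℝ} (h0 : 0 ≤ ρ) (h1 : ρ < 1)
    {S : Set (ι → ℝ)} (hS : MeasurableSet S) (m : ℕ) :
    (gaussianPi ι v S) ^ 2 ^ (m + 1) ≤
      ∫⁻ x, S.indicator 1 x * (killedOperator v ρ S)^[2 ^ m] (S.indicator 1) x
        ∂(gaussianPi ι v) := by
  have hind : Measurable (S.indicator (1 : (ι → ℝ) → ℝ≥0∞)) := measurable_one.indicator hS
  have hsq : ∀ x, S.indicator (1 : (ι → ℝ) → ℝ≥0∞) x * S.indicator 1 x = S.indicator 1 x :=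
    fun x => by by_cases hx : x ∈ S <;> simp [hx]
  induction m with
  | zero =>
    have hr0 : 0 ≤ √ρ := Real.sqrt_nonneg _
    have hr1 : √ρ ≤ 1 := Real.sqrt_le_one.2 h1.le
    simp only [pow_zero, Function.iterate_one, zero_add, pow_one]
    -- One step: the integral is the squared $L^2$ norm of the operator with correlation $\sqrt\rho$
    -- applied to the indicator, which is at least the square of its mean.
    have e1 : ∀ x, S.indicator (1 : (ι → ℝ) → ℝ≥0∞) x * killedOperator v ρ S (S.indicator 1) x =
        S.indicator 1 x * ouOperator v (√ρ) (ouOperator v (√ρ) (S.indicator 1)) x := fun x => by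
      rw [killedOperator, ← mul_assoc, hsq]
      simp_rw [hsq]
      rw [ouOperator_sqrt_sqrt v h0 h1 hind]
    simp_rw [e1]
    rw [lintegral_mul_ouOperator v hr0 hr1 hind (measurable_ouOperator v _ hind)]
    refine le_trans (le_of_eq ?_) (sq_lintegral_le _ (measurable_ouOperator v _ hind))
    rw [lintegral_ouOperator v hr0 hr1 hind, lintegral_indicator_one hS]
  | succ m ih =>
    have hm := measurable_iterate_killedOperator v ρ hS hind (2 ^ m)
    -- Half of the steps are moved to the other factor by self-adjointness; Cauchy–Schwarz then
    -- squares the previous bound.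
    have e : 2 ^ (m + 1) = 2 ^ m + 2 ^ m := by ring
    rw [e, Function.iterate_add_apply, lintegral_iterate_killedOperator v h0 h1.le hS _ hind hm]
    refine le_trans ?_ (sq_lintegral_le _ hm)
    rw [pow_succ 2 (m + 1), pow_mul]
    gcongr
    refine ih.trans (lintegral_mono fun x => ?_)
    by_cases hx : x ∈ S <;> simp [hx]

/-- The law of an i.i.d. sequence of Gaussian vectors. -/
noncomputable abbrev noiseLaw (ι : Type*) [Fintype ι] (v : ℝ≥0) : Measure (ℕ → ι → ℝ) :=
  Measure.infinitePi fun _ => gaussianPi ι v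

/-- A function of the first `n + 1` noise vectors is independent of the next one. -/
lemma measurePreserving_prodMk_noise (v : ℝ≥0) {F : Type*} [MeasurableSpace F]
    {f : (ℕ → ι → ℝ) → F} (hf : Measurable f) {n : ℕ}
    (hdep : ∀ ω ω', (∀ k ≤ n, ω k = ω' k) → f ω = f ω') :
    MeasurePreserving (fun ω => (f ω, ω (n + 1))) (noiseLaw ι v)
      (((noiseLaw ι v).map f).prod (gaussianPi ι v)) := by
  classical
  have hind : iIndepFun (fun (k : ℕ) (ω : ℕ → ι → ℝ) => ω k) (noiseLaw ι v) :=
    iIndepFun_infinitePi (X := fun _ x => x) (fun _ => measurable_id)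
  have h1 := hind.indepFun_finset (Finset.range (n + 1)) {n + 1} (by simp)
    (fun k => measurable_pi_apply k)
  -- Extension by zero: `f` sees only the coordinates up to `n`, hence factors through them.
  let ext : ((Finset.range (n + 1)) → ι → ℝ) → ℕ → ι → ℝ := fun y k =>
    if h : k ∈ Finset.range (n + 1) then y ⟨k, h⟩ else 0
  have hext : Measurable ext := by
    refine measurable_pi_lambda _ fun k => ?_
    by_cases h : k ∈ Finset.range (n + 1)
    · simp only [ext, h, dif_pos]; fun_prop
    · simp only [ext, h, dif_neg, not_false_eq_true]; fun_prop
  have hψ : Measurable fun y : ({n + 1} : Finset ℕ) → ι → ℝ =>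
      y ⟨n + 1, Finset.mem_singleton_self _⟩ := measurable_pi_apply _
  have h2 := h1.comp (φ := fun y => f (ext y)) (hf.comp hext) hψ
  have e1 : ((fun y => f (ext y)) ∘ fun (ω : ℕ → ι → ℝ) (k : Finset.range (n + 1)) => ω k) = f := by
    funext ω
    refine hdep _ _ fun k hk => ?_
    simp only [ext, Finset.mem_range, Nat.lt_succ_of_le hk, dif_pos]
  rw [e1] at h2
  have h3 := (indepFun_iff_map_prod_eq_prod_map_map hf.aemeasurable
    (measurable_pi_apply (n + 1)).aemeasurable).1 h2
  refine ⟨hf.prodMk (measurable_pi_apply _), ?_⟩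
  rw [h3]
  congr 1
  exact (measurePreserving_eval_infinitePi _ (n + 1)).map_eq

lemma measurePreserving_noise (v : ℝ≥0) (n : ℕ) :
    MeasurePreserving (fun ω : ℕ → ι → ℝ => ω n) (noiseLaw ι v) (gaussianPi ι v) :=
  measurePreserving_eval_infinitePi _ n

lemma measurePreserving_chain (v : ℝ≥0) {ρ : ℝ} (h0 : 0 ≤ ρ) (h1 : ρ ≤ 1) (n : ℕ) :
    MeasurePreserving (fun ω : ℕ → ι → ℝ => chain ρ ω n) (noiseLaw ι v) (gaussianPi ι v) := by
  induction n with
  | zero => exact measurePreserving_noise v 0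
  | succ n ih =>
    have h := measurePreserving_prodMk_noise v (measurable_chain (ι := ι) ρ n)
      fun _ _ => chain_congr ρ
    rw [ih.map_eq] at h
    exact (measurePreserving_combination v (sq_add_sq_sqrt h0 h1)).comp h

/-- The starting point and the fresh part are independent Gaussian vectors. -/
lemma measurePreserving_freshPart (v : ℝ≥0) {ρ : ℝ} (h0 : 0 ≤ ρ) (h1 : ρ < 1) (n : ℕ) :
    MeasurePreserving (fun ω : ℕ → ι → ℝ => (ω 0, freshPart ρ ω (n + 1))) (noiseLaw ι v)
      ((gaussianPi ι v).prod (gaussianPi ι v)) := by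
  induction n with
  | zero =>
    have h := measurePreserving_prodMk_noise v (f := fun ω : ℕ → ι → ℝ => ω 0) (n := 0)
      (by fun_prop) fun _ _ h => h 0 le_rfl
    rw [(measurePreserving_noise v 0).map_eq] at h
    have hs : √(1 - ρ ^ 2) ≠ 0 := (Real.sqrt_pos.2 (by simpa using one_sub_pow_pos h0 h1 0)).ne'
    convert h using 3 with ω
    simp [freshPart, div_self hs]
  | succ n ih =>
    have h := measurePreserving_prodMk_noise v (n := n + 1)
      (f := fun ω : ℕ → ι → ℝ => (ω 0, freshPart ρ ω (n + 1)))
      ((measurable_pi_apply 0).prodMk (measurable_freshPart ρ (n + 1)))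
      fun _ _ h => by rw [h 0 (by omega), freshPart_congr ρ h]
    rw [ih.map_eq] at h
    have hp1 := one_sub_pow_pos h0 h1 n
    have hp2 := one_sub_pow_pos h0 h1 (n + 1)
    have hab : (ρ * √(1 - ρ ^ (2 * (n + 1))) / √(1 - ρ ^ (2 * (n + 1 + 1)))) ^ 2 +
        (√(1 - ρ ^ 2) / √(1 - ρ ^ (2 * (n + 1 + 1)))) ^ 2 = 1 := by
      rw [div_pow, div_pow, mul_pow, Real.sq_sqrt hp1.le, Real.sq_sqrt hp2.le,
        Real.sq_sqrt (by nlinarith), ← add_div, div_eq_one_iff_eq hp2.ne']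
      ring
    have hc := (MeasurePreserving.id (gaussianPi ι v)).prod
      (measurePreserving_combination (ι := ι) v hab)
    have ha := measurePreserving_prodAssoc (gaussianPi ι v) (gaussianPi ι v) (gaussianPi ι v)
    exact hc.comp (ha.comp h)

/-- The Markov property: integrating out the last noise vector, independent of the past, turns the
last step into one application of the killed operator to `g`. -/
lemma lintegral_chain (v : ℝ≥0) (ρ : ℝ) {S : Set (ι → ℝ)} (hS : MeasurableSet S) (n : ℕ) :
    ∀ {g : (ι → ℝ) → ℝ≥0∞}, Measurable g →
    ∫⁻ ω, (∏ k ∈ Finset.range (n + 1), S.indicator 1 (chain ρ ω k)) * g (chain ρ ω n)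
      ∂(noiseLaw ι v) =
    ∫⁻ x, S.indicator 1 x * (killedOperator v ρ S)^[n] g x ∂(gaussianPi ι v) := by
  have hind : Measurable (S.indicator (1 : (ι → ℝ) → ℝ≥0∞)) := measurable_one.indicator hS
  induction n with
  | zero =>
    intro g hg
    simp only [zero_add, Finset.range_one, Finset.prod_singleton, Function.iterate_zero, id]
    have := (measurePreserving_noise (ι := ι) v 0).lintegral_comp (hind.mul hg)
    simpa [chain] using this
  | succ n ih =>
    intro g hg
    rw [Function.iterate_succ_apply, ← ih (measurable_killedOperator v ρ hS hg)]
    have hmeas : Measurable fun ω : ℕ → ι → ℝ =>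
        ∏ k ∈ Finset.range (n + 1), S.indicator (1 : (ι → ℝ) → ℝ≥0∞) (chain ρ ω k) :=
      Finset.measurable_prod _ fun k _ => hind.comp (measurable_chain ρ k)
    have hF : Measurable fun ω : ℕ → ι → ℝ =>
        (∏ k ∈ Finset.range (n + 1), S.indicator (1 : (ι → ℝ) → ℝ≥0∞) (chain ρ ω k),
          chain ρ ω n) := hmeas.prodMk (measurable_chain ρ n)
    have h := measurePreserving_prodMk_noise v hF (n := n) fun ω ω' h => by
      refine Prod.ext ?_ (chain_congr ρ h)
      change ∏ k ∈ Finset.range (n + 1), S.indicator (1 : (ι → ℝ) → ℝ≥0∞) (chain ρ ω k) =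
        ∏ k ∈ Finset.range (n + 1), S.indicator (1 : (ι → ℝ) → ℝ≥0∞) (chain ρ ω' k)
      refine Finset.prod_congr rfl fun k hk => ?_
      rw [chain_congr ρ fun l hl => h l (hl.trans (Nat.lt_succ_iff.1 (Finset.mem_range.1 hk)))]
    have hG : Measurable fun z : (ℝ≥0∞ × (ι → ℝ)) × (ι → ℝ) =>
        z.1.1 * (S.indicator 1 (ρ • z.1.2 + √(1 - ρ ^ 2) • z.2) *
          g (ρ • z.1.2 + √(1 - ρ ^ 2) • z.2)) := by
      have : Measurable fun z : (ℝ≥0∞ × (ι → ℝ)) × (ι → ℝ) => ρ • z.1.2 + √(1 - ρ ^ 2) • z.2 := by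
        fun_prop
      exact (measurable_fst.comp measurable_fst).mul ((hind.comp this).mul (hg.comp this))
    have e := h.lintegral_comp hG
    rw [lintegral_prod _ hG.aemeasurable, lintegral_map hG.lintegral_prod_right' hF] at e
    calc _ = _ := lintegral_congr fun ω => by
          rw [Finset.prod_range_succ, chain, mul_assoc]
      _ = _ := e
      _ = _ := lintegral_congr fun ω => by
        have hm : Measurable fun z : ι → ℝ =>
            S.indicator 1 (ρ • chain ρ ω n + √(1 - ρ ^ 2) • z) *
              g (ρ • chain ρ ω n + √(1 - ρ ^ 2) • z) :=
          (hind.comp (by fun_prop)).mul (hg.comp (by fun_prop))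
        rw [lintegral_const_mul _ hm, killedOperator, ouOperator, Finset.prod_range_succ]
        have hsq : ∀ x, S.indicator (1 : (ι → ℝ) → ℝ≥0∞) x * S.indicator 1 x =
          S.indicator 1 x := fun x => by by_cases hx : x ∈ S <;> simp [hx]
        rw [mul_assoc _ _ (S.indicator 1 (chain ρ ω n) * _), ← mul_assoc (S.indicator 1 (chain ρ ω n)),
          hsq, mul_assoc]

/-- The stationary chain stays in `S` for `2^m` steps with probability at least
`γ(S)^(2^(m+1))`. -/
lemma pow_measure_le_measure_chain (v : ℝ≥0) {ρ : ℝ} (h0 : 0 ≤ ρ) (h1 : ρ < 1)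
    {S : Set (ι → ℝ)} (hS : MeasurableSet S) (m : ℕ) :
    (gaussianPi ι v).real S ^ 2 ^ (m + 1) ≤
      (noiseLaw ι v).real {ω | ∀ k ≤ 2 ^ m, chain ρ ω k ∈ S} := by
  have hind : Measurable (S.indicator (1 : (ι → ℝ) → ℝ≥0∞)) := measurable_one.indicator hS
  have h := pow_measure_le_lintegral_iterate v h0 h1 hS m
  rw [← lintegral_chain v ρ hS _ hind] at h
  have hE : {ω : ℕ → ι → ℝ | ∀ k ≤ 2 ^ m, chain ρ ω k ∈ S} =
      ⋂ k ∈ Set.Iic (2 ^ m), (fun ω : ℕ → ι → ℝ => chain ρ ω k) ⁻¹' S := by ext; simp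
  have hEm : MeasurableSet {ω : ℕ → ι → ℝ | ∀ k ≤ 2 ^ m, chain ρ ω k ∈ S} := by
    rw [hE]
    exact MeasurableSet.biInter (Set.to_countable _) fun k _ => measurable_chain ρ k hS
  have h2 : ∫⁻ ω, (∏ k ∈ Finset.range (2 ^ m + 1), S.indicator 1 (chain ρ ω k)) *
      S.indicator 1 (chain ρ ω (2 ^ m)) ∂(noiseLaw ι v) ≤
      noiseLaw ι v {ω | ∀ k ≤ 2 ^ m, chain ρ ω k ∈ S} := by
    rw [← lintegral_indicator_one hEm]
    refine lintegral_mono fun ω => ?_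
    by_cases hω : ∀ k ≤ 2 ^ m, chain ρ ω k ∈ S
    · have hω' : ω ∈ {ω : ℕ → ι → ℝ | ∀ k ≤ 2 ^ m, chain ρ ω k ∈ S} := hω
      rw [Set.indicator_of_mem hω']
      have : ∀ x, S.indicator (1 : (ι → ℝ) → ℝ≥0∞) x ≤ 1 := fun x =>
        Set.indicator_le_self' (fun _ _ => zero_le) x
      exact mul_le_one' (Finset.prod_le_one' fun k _ => this _) (this _)
    · push Not at hω
      obtain ⟨k, hk, hkS⟩ := hω
      rw [Finset.prod_eq_zero (Finset.mem_range.2 (Nat.lt_succ_of_le hk))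
        (Set.indicator_of_notMem hkS _), zero_mul]
      exact zero_le
  have h3 := ENNReal.toReal_mono (measure_ne_top _ _) (h.trans h2)
  rwa [ENNReal.toReal_pow] at h3

end Chain

end PSpin

namespace PSpin

variable {p r N : ℕ}

/-! ### From an energy gap to a gap in TAP free energy. -/

section FreeEnergy

/-- Both $1\pm x$ lie in $[0,2]$ and sum to 2, so each logarithm may be replaced by $\log 2$. -/
lemma bernoulliEntropy_le {x : ℝ} (hx : x ∈ Set.Icc (-1 : ℝ) 1) :
    bernoulliEntropy x ≤ Real.log 2 := by
  have key : ∀ y : ℝ, 0 ≤ y → y ≤ 2 → y * Real.log y ≤ y * Real.log 2 := by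
    intro y h0 h2
    rcases h0.eq_or_lt with rfl | h0
    · simp
    · exact mul_le_mul_of_nonneg_left (Real.log_le_log h0 h2) h0.le
  have h1 := key (1 + x) (by linarith [hx.1]) (by linarith [hx.2])
  have h2 := key (1 - x) (by linarith [hx.2]) (by linarith [hx.1])
  rw [bernoulliEntropy]
  linarith

lemma bernoulliEntropy_corner {x : ℝ} (hx : x = -1 ∨ x = 1) :
    bernoulliEntropy x = Real.log 2 := by
  rcases hx with rfl | rfl <;> norm_num [bernoulliEntropy]

/-- In $1-x^p=(1-x)\sum_{i<p}x^i$ every term of the sum is at least $x^{p-1}$. -/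
lemma onsager_nonneg (p : ℕ) (β : ℝ) {x : ℝ} (h0 : 0 ≤ x) (h1 : x ≤ 1) : 0 ≤ onsager p β x := by
  refine mul_nonneg (by positivity) ?_
  rw [← mul_neg_geom_sum x p]
  have : p * x ^ (p - 1) ≤ ∑ i ∈ Finset.range p, x ^ i := by
    have := Finset.card_nsmul_le_sum (Finset.range p) (fun i => x ^ i) (x ^ (p - 1)) fun i hi =>
      pow_le_pow_of_le_one h0 h1 (by have := Finset.mem_range.1 hi; omega)
    simpa using this
  nlinarith

lemma onsager_one (p : ℕ) (β : ℝ) : onsager p β 1 = 0 := by simp [onsager]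

lemma le_tapFreeEnergy (hN : 0 < N) {β s κ : ℝ} (hs : 0 ≤ s) (hκ : 0 ≤ κ) (A : Tensor p N)
    {x : Vec N} (hx : x ∈ cube N) :
    β * A.form x - s * (N * Real.log 2) ≤ tapFreeEnergy β s κ A x := by
  have hNr : (0 : ℝ) < N := by exact_mod_cast hN
  have h1 : ∑ i, bernoulliEntropy (x i) ≤ N * Real.log 2 := by
    have := Finset.sum_le_card_nsmul Finset.univ (fun i => bernoulliEntropy (x i)) _
      fun i _ => bernoulliEntropy_le (hx i)
    simpa using this
  have h2 : ‖x‖ ^ 2 / N ≤ 1 := by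
    rw [div_le_one hNr]
    have := pow_le_pow_left₀ (norm_nonneg x) (norm_le_sqrt_of_mem_cube hx) 2
    rwa [Real.sq_sqrt hNr.le] at this
  have h3 := mul_nonneg hκ (onsager_nonneg p β (by positivity) h2)
  have h4 := mul_le_mul_of_nonneg_left h1 hs
  rw [tapFreeEnergy]
  linarith

lemma tapFreeEnergy_corner (hN : 0 < N) (β s κ : ℝ) (A : Tensor p N) {σ : Vec N}
    (hσ : σ ∈ binaryCube N) :
    tapFreeEnergy β s κ A σ = β * A.form σ - s * (N * Real.log 2) := by
  have hNr : (0 : ℝ) < N := by exact_mod_cast hN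
  have h1 : ∀ i, ‖σ i‖ ^ 2 = 1 := fun i => by
    rcases hσ i with h | h <;> rw [h] <;> norm_num
  have h2 : ‖σ‖ ^ 2 / N = 1 := by
    rw [EuclideanSpace.norm_sq_eq, Finset.sum_congr rfl fun i _ => h1 i]
    simp [hNr.ne']
  rw [tapFreeEnergy, h2, onsager_one, Finset.sum_congr rfl fun i _ => bernoulliEntropy_corner (hσ i)]
  simp

/-- A gap between the objective at a point of the cube and the ground state energy is a gap in
TAP free energy, whatever the weights. -/
lemma sInf_tapFreeEnergy_add_le (hN : 0 < N) {β s κ μ : ℝ} (hβ : 0 < β) (hs : 0 ≤ s) (hκ : 0 ≤ κ)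
    (A : Tensor p N) {x : Vec N} (hx : x ∈ cube N) (h : groundState A + μ ≤ A.form x / N) :
    sInf (tapFreeEnergy β s κ A '' cube N) / (β * N) + μ ≤
      tapFreeEnergy β s κ A x / (β * N) := by
  have hNr : (0 : ℝ) < N := by exact_mod_cast hN
  have hbdd : BddBelow (tapFreeEnergy β s κ A '' cube N) := by
    refine ⟨-(β * ∑ J, |A J|) - s * (N * Real.log 2), ?_⟩
    rintro _ ⟨y, hy, rfl⟩
    have h1 := le_tapFreeEnergy (β := β) hN hs hκ A hy
    have h2 := mul_le_mul_of_nonneg_left (abs_le.1 (abs_form_le A hy)).1 hβ.le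
    linarith
  set E := s * (N * Real.log 2)
  -- The entropy term equals `E` at every corner and is at most `E` on the cube, so it cancels
  -- whatever `s` is; the correction vanishes at corners and only helps elsewhere.
  have h1 : (sInf (tapFreeEnergy β s κ A '' cube N) + E) / β ≤ sInf (A.form '' binaryCube N) := by
    refine le_csInf (binaryCube_nonempty.image _) ?_
    rintro _ ⟨σ, hσ, rfl⟩
    have h2 := csInf_le hbdd ⟨σ, binaryCube_subset_cube hσ, rfl⟩
    rw [tapFreeEnergy_corner hN β s κ A hσ] at h2
    rw [div_le_iff₀ hβ]
    linarith
  have h2 : (sInf (A.form '' binaryCube N) / N + μ) * N ≤ A.form x := by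
    rw [← le_div_iff₀ hNr]; exact h
  rw [add_mul, div_mul_cancel₀ _ hNr.ne'] at h2
  rw [div_le_iff₀ hβ] at h1
  have h3 := le_tapFreeEnergy (β := β) hN hs hκ A hx
  have h4 := mul_le_mul_of_nonneg_left h2 hβ.le
  rw [div_add' _ _ _ (by positivity)]
  gcongr
  linarith

end FreeEnergy

/-! ### Overlaps along a slowly moving sequence. -/

section Overlap

variable {E : Type*} [NormedAddCommGroup E] [InnerProductSpace ℝ E]

/-- One $\|x-y\|$ comes from the inner product and one from the normalisation. Only `y` has to be
nonzero: the overlap with a zero vector reads 0. -/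
lemma overlap_sub_le (u x : E) {y : E} (hy : y ≠ 0) :
    |inner ℝ u y| / (‖u‖ * ‖y‖) - |inner ℝ u x| / (‖u‖ * ‖x‖) ≤ 2 * ‖x - y‖ / ‖y‖ := by
  have hy0 : 0 < ‖y‖ := norm_pos_iff.2 hy
  rcases eq_or_ne u 0 with rfl | hu
  · simp; positivity
  have hu0 : 0 < ‖u‖ := norm_pos_iff.2 hu
  set f : E → ℝ := fun z => |inner ℝ u z| / ‖u‖ with hf
  have hf1 : ∀ z, f z ≤ ‖z‖ := fun z => by
    rw [hf, div_le_iff₀ hu0, mul_comm]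
    exact abs_real_inner_le_norm u z
  have hf0 : ∀ z, 0 ≤ f z := fun z => by positivity
  have hf2 : f y ≤ f x + ‖x - y‖ := by
    have h1 := hf1 (x - y)
    have h2 : f y ≤ f x + f (x - y) := by
      simp only [hf, ← add_div, inner_sub_right]
      gcongr
      have := abs_sub_abs_le_abs_sub (inner ℝ u y) (inner ℝ u x)
      rw [abs_sub_comm] at this
      linarith
    linarith
  have e : ∀ z, |inner ℝ u z| / (‖u‖ * ‖z‖) = f z / ‖z‖ := fun z => by
    rw [hf, div_div]
  rw [e, e]
  rcases eq_or_ne x 0 with rfl | hx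
  · have h0 : f 0 = 0 := by simp [hf]
    simp only [h0, zero_div, sub_zero, zero_sub, norm_neg]
    gcongr
    linarith [hf1 y]
  have hx0 : 0 < ‖x‖ := norm_pos_iff.2 hx
  have h3 : f x / ‖y‖ - f x / ‖x‖ ≤ ‖x - y‖ / ‖y‖ := by
    have h4 : f x / ‖y‖ - f x / ‖x‖ = f x / ‖x‖ * ((‖x‖ - ‖y‖) / ‖y‖) := by field_simp
    have h5 : f x / ‖x‖ ≤ 1 := (div_le_one hx0).2 (hf1 x)
    rw [h4]
    calc f x / ‖x‖ * ((‖x‖ - ‖y‖) / ‖y‖) ≤ f x / ‖x‖ * (‖x - y‖ / ‖y‖) := by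
          gcongr
          exact norm_sub_norm_le x y
      _ ≤ 1 * (‖x - y‖ / ‖y‖) := by gcongr
      _ = _ := one_mul _
  have h6 : f y / ‖y‖ ≤ f x / ‖y‖ + ‖x - y‖ / ‖y‖ := by rw [← add_div]; gcongr
  have h7 : 2 * ‖x - y‖ / ‖y‖ = ‖x - y‖ / ‖y‖ + ‖x - y‖ / ‖y‖ := by ring
  linarith

/-- A slowly moving sequence whose overlaps with its starting point avoid an interval cannot
become nearly orthogonal to it. -/
lemma overlap_ge_of_small_steps {V : ℕ → E} {K : ℕ} {ν₁ ν₂ R : ℝ} (hν₂ : ν₂ ≤ 1)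
    (hR : 0 < R) (hnorm : ∀ k ≤ K, R ≤ ‖V k‖)
    (hstep : ∀ k < K, 2 * ‖V k - V (k + 1)‖ < (ν₂ - ν₁) * R)
    (hgap : ∀ k ≤ K, |inner ℝ (V 0) (V k)| / (‖V 0‖ * ‖V k‖) ∈ Set.Icc 0 ν₁ ∪ Set.Icc ν₂ 1) :
    ν₂ * R ^ 2 ≤ |inner ℝ (V 0) (V K)| ∨ ν₂ < 0 := by
  by_cases hneg : ν₂ < 0
  · exact .inr hneg
  refine .inl ?_
  have h0 : 0 < ‖V 0‖ := hR.trans_le (hnorm 0 (Nat.zero_le _))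
  -- The overlap is 1 at the start, and one step lowers it by less than the width of the forbidden
  -- interval.
  have key : ∀ k ≤ K, ν₂ ≤ |inner ℝ (V 0) (V k)| / (‖V 0‖ * ‖V k‖) := by
    intro k
    induction k with
    | zero =>
      intro _
      rw [real_inner_self_eq_norm_mul_norm, abs_of_nonneg (by positivity), div_self (by positivity)]
      exact hν₂
    | succ k ih =>
      intro hk
      have hpos : 0 < ‖V k‖ := hR.trans_le (hnorm k (by omega))
      have h1 := overlap_sub_le (V 0) (V (k + 1)) (norm_pos_iff.1 hpos)
      have h2 : 2 * ‖V (k + 1) - V k‖ / ‖V k‖ < ν₂ - ν₁ := by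
        rw [div_lt_iff₀ hpos, norm_sub_rev]
        have h3 := hstep k (by omega)
        have h4 : 0 < ν₂ - ν₁ := by
          by_contra hcon
          have := mul_nonpos_of_nonpos_of_nonneg (not_lt.1 hcon) hR.le
          linarith [norm_nonneg (V k - V (k + 1))]
        refine h3.trans_le ?_
        gcongr
        exact hnorm k (by omega)
      rcases hgap (k + 1) hk with h | h
      · linarith [h.2, ih (by omega)]
      · exact h.1
  have hKpos : 0 < ‖V K‖ := hR.trans_le (hnorm K le_rfl)
  have h1 := key K le_rfl
  rw [le_div_iff₀ (by positivity)] at h1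
  refine le_trans ?_ h1
  have h2 := mul_le_mul (hnorm 0 (Nat.zero_le _)) (hnorm K le_rfl) hR.le h0.le
  rw [pow_two]
  exact mul_le_mul_of_nonneg_left h2 (not_lt.1 hneg)

end Overlap

/-- Stated for arbitrary `B`, since the overlap gap events quantify over uncountable families and
their measurability is not established; the inequality for outer measures suffices. -/
lemma measureReal_preimage_le {α γ : Type*} [MeasurableSpace α] [MeasurableSpace γ]
    {P : Measure α} {Q : Measure γ} [IsFiniteMeasure Q] {f : α → γ} (hf : MeasurePreserving f P Q)
    (B : Set γ) : P.real (f ⁻¹' B) ≤ Q.real B := by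
  refine ENNReal.toReal_mono (measure_ne_top _ _) ?_
  rw [← hf.map_eq]
  exact Measure.le_map_apply hf.measurable.aemeasurable B

lemma abs_form_le_of_injBound {A : Tensor p N} {C : ℝ} (hA : InjBound A C) (x : Vec N) :
    |A.form x| ≤ C * N * (‖x‖ / √N) ^ p := by
  rw [form_eq_multiform]
  exact (hA fun _ => x).trans_eq (by rw [Finset.prod_const, Finset.card_univ, Fintype.card_fin])

lemma form_add_smul (a b : ℝ) (A B : Tensor p N) (u : Vec N) :
    (a • A + b • B).form u = a * A.form u + b * B.form u := by
  simp only [form_eq_multiform, multiform_add_smul]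

/-! ### Contradiction along a successful chain. -/

/-- The near optimality event for the output of the iteration. -/
def successSet (p N : ℕ) (β M q : ℝ) (a : ℕ → ℝ) (T : ℕ) (μ : ℝ) : Set (Tensor p N) :=
  {A | A.form (tapOutput A β M q a T) / N < groundState A + μ}

/-- The event is open, its inequality being strict between continuous functions. Measurability is
needed for the killed operator and for passing to the complement. -/
lemma measurableSet_successSet (β M q : ℝ) (a : ℕ → ℝ) (T : ℕ) (μ : ℝ) :
    MeasurableSet (successSet p N β M q a T μ) := by
  refine (isOpen_lt ?_ ?_).measurableSet
  · exact (continuous_form.comp (continuous_id.prodMk (continuous_tapOutput β M q a T))).div_const _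
  · exact continuous_groundState.add continuous_const

/-- The tensors with the typical norm and ground state energy. -/
def typicalSet (p N : ℕ) (C b θ : ℝ) : Set (Tensor p N) :=
  {A | InjBound A C ∧ groundState A ≤ sInf (A.form '' cube N) / N + 2 * b ∧
    groundState A ≤ ∫ B, groundState B ∂(gaussianTensor p N) + θ}

/-- The pairs of tensors with both properties asserted by the conjecture. -/
def gapSet (p N : ℕ) (μ ν₁ ν₂ ε δ : ℝ) : Set (Tensor p N × Tensor p N) :=
  {AA | OverlapGapProperty (interpolation AA.1 AA.2) (cube N) μ ν₁ ν₂ ∧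
    ∀ v₁ ∈ cube N, ∀ v₂ ∈ cube N,
      AA.1.form v₁ / N ≤ (1 - δ) * ∫ A, groundState A ∂(gaussianTensor p N) →
      AA.2.form v₂ / N ≤ (1 - δ) * ∫ A, groundState A ∂(gaussianTensor p N) →
      |inner ℝ v₁ v₂| ≤ ε * N}

lemma eventually_measure_compl_typicalSet_le (hp : 0 < p) {C b θ : ℝ}
    (hC : ∀ N : ℕ, 0 < N → (gaussianTensor p N).real {A | ¬ InjBound A C} ≤ Real.exp (-N))
    (hb : 0 < b) (hθ : 0 < θ) {c : ℝ} (hc1 : c ≤ 1) (hcθ : c ≤ θ ^ 2 / 4) :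
    ∀ᶠ N : ℕ in atTop, (gaussianTensor p N).real (typicalSet p N C b θ)ᶜ ≤
      3 * Real.exp (-c * N) := by
  filter_upwards [eventually_measure_groundState_gt_le hp hb, eventually_gt_atTop 0] with N h2 hN
  have h1 := hC N hN
  have h3 := measure_groundState_ge_le hp hN hθ.le
  have hN0 : (0 : ℝ) ≤ N := by positivity
  have hsub : (typicalSet p N C b θ)ᶜ ⊆ {A | ¬ InjBound A C} ∪
      {A | ¬ groundState A ≤ sInf (A.form '' cube N) / N + 2 * b} ∪
      {A | ∫ B, groundState B ∂(gaussianTensor p N) + θ ≤ groundState A} := by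
    intro A hA
    by_contra hcon
    simp only [Set.mem_union, Set.mem_ofPred_eq, not_or, not_not, not_le] at hcon
    exact hA ⟨hcon.1.1, not_lt.1 hcon.1.2, hcon.2.le⟩
  have h4 : Real.exp (-N) ≤ Real.exp (-c * N) := Real.exp_le_exp.2 (by nlinarith)
  have h5 : Real.exp (-(θ ^ 2 / 4) * N) ≤ Real.exp (-c * N) := Real.exp_le_exp.2 (by nlinarith)
  calc _ ≤ _ := measureReal_mono hsub (measure_ne_top _ _)
    _ ≤ _ := (measureReal_union_le _ _).trans (add_le_add_left (measureReal_union_le _ _) _)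
    _ ≤ _ := by linarith

/-- Along a chain of typical tensors with the overlap gap property the iteration fails at least
once. -/
lemma false_of_chain_success (hN : 0 < N) {C b θ μ ν₁ ν₂ ε δ R c₀ μ' β M q L ρ : ℝ}
    {a : ℕ → ℝ} {T j : ℕ} (hC : 0 < C) (hμ' : 2 * b + μ' ≤ μ)
    (hν : ν₁ < ν₂) (hν₁ : 0 < ν₁) (hν₂ : ν₂ < 1) (hc₀ : 0 < c₀) (hθ : 0 < θ) (hμθ : μ' ≤ θ)
    (hR : 0 < R) (hRC : C * R ^ (r + 1) ≤ c₀ / 2) (hε : ε < ν₂ * R ^ 2)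
    (hmean : ∫ A, groundState A ∂(gaussianTensor (r + 1) N) ≤ -c₀)
    (hθ1 : 4 * θ ≤ c₀) (hθδ : 4 * θ ≤ δ * c₀)
    (hL : ∀ A B : Tensor (r + 1) N, ∀ d : ℝ, 0 ≤ d → InjBound A C → InjBound (A - B) d →
        ‖tapOutput A β M q a T - tapOutput B β M q a T‖ ≤ L * d * √N)
    (hρ0 : 0 < ρ) (hρ1 : ρ < 1)
    (hρL : 2 * (L * ((1 - ρ) * C + √(1 - ρ ^ 2) * C)) < (ν₂ - ν₁) * R)
    (hρK : ρ ^ (j + 1) * C ≤ θ)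
    (ω : ℕ → Tensor (r + 1) N)
    (hS : ∀ k ≤ j + 1, chain ρ ω k ∈ successSet (r + 1) N β M q a T μ')
    (hX : ∀ k ≤ j + 1, chain ρ ω k ∈ typicalSet (r + 1) N C b θ)
    (hZ : ∀ k ≤ j + 1, ω (k + 1) ∈ typicalSet (r + 1) N C b θ)
    (hW : ∀ k ≤ j + 1, (ω 0, freshPart ρ ω (k + 1)) ∈ gapSet (r + 1) N μ ν₁ ν₂ ε δ) : False := by
  have hNr : (0 : ℝ) < N := by exact_mod_cast hN
  have hsN : 0 < √(N : ℝ) := Real.sqrt_pos.2 hNr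
  set m := ∫ A, groundState A ∂(gaussianTensor (r + 1) N) with hm
  set V : ℕ → Vec N := fun k => tapOutput (chain ρ ω k) β M q a T with hV
  have hVc : ∀ k, V k ∈ cube N := fun k => trunc_mem_cube _
  have hen : ∀ k ≤ j + 1, Tensor.form (chain ρ ω k) (V k) / N < m + θ + μ' := fun k hk => by
    have h1 : Tensor.form (chain ρ ω k) (V k) / N < groundState (chain ρ ω k) + μ' := hS k hk
    linarith [(hX k hk).2.2]
  -- A shorter vector would have energy above $-c_0/2$ per site, whereas success on a typical tensor
  -- puts it below.
  have hnorm : ∀ k ≤ j + 1, R * √N ≤ ‖V k‖ := by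
    intro k hk
    by_contra hcon
    have h1 := abs_form_le_of_injBound (hX k hk).1 (V k)
    have h2 : ‖V k‖ / √N ≤ R := by rw [div_le_iff₀ hsN]; exact (not_le.1 hcon).le
    have h3 : C * N * (‖V k‖ / √N) ^ (r + 1) ≤ C * N * R ^ (r + 1) := by gcongr
    have h4 := hen k hk
    rw [div_lt_iff₀ hNr] at h4
    have h5 := (abs_le.1 (h1.trans h3)).1
    have h6 := mul_le_mul_of_nonneg_right hRC hNr.le
    have h7 : (m + θ + μ') * N ≤ -(c₀ / 2) * N := by gcongr; linarith
    linarith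
  have hopt : ∀ k ≤ j + 1, Tensor.form (chain ρ ω k) (V k) / N ≤
      sInf (Tensor.form (chain ρ ω k) '' cube N) / N + μ := fun k hk => by
    have h1 : Tensor.form (chain ρ ω k) (V k) / N < groundState (chain ρ ω k) + μ' := hS k hk
    linarith [(hX k hk).2.1]
  have h0mem : ∀ B : Tensor (r + 1) N, chain ρ ω 0 ∈ interpolation (ω 0) B := fun B =>
    ⟨0, by norm_num, by simp [chain]⟩
  have hgap : ∀ k ≤ j + 1, |inner ℝ (V 0) (V k)| / (‖V 0‖ * ‖V k‖) ∈
      Set.Icc 0 ν₁ ∪ Set.Icc ν₂ 1 := by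
    intro k hk
    -- Time 0 has no fresh part; any pair starting at `ω 0` serves, as both tensors are then the
    -- endpoint `τ = 0`.
    rcases k with _ | k
    · exact (hW 0 (by omega)).1 _ (h0mem _) _ (h0mem _) _ (hVc 0) _ (hVc 0)
        (hopt 0 (by omega)) (hopt 0 (by omega))
    · refine (hW k (by omega)).1 _ (h0mem _) _ ?_ _ (hVc 0) _ (hVc (k + 1))
        (hopt 0 (by omega)) (hopt (k + 1) hk)
      have hpos := one_sub_pow_pos hρ0.le hρ1 k
      refine ⟨1 - ρ ^ (2 * (k + 1)), ⟨hpos.le, by linarith [pow_pos hρ0 (2 * (k + 1))]⟩, ?_⟩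
      rw [chain_eq hρ0.le hρ1]
      simp only [sub_sub_cancel]
      rw [mul_comm 2, pow_mul, Real.sqrt_sq (by positivity)]
  have hstep : ∀ k < j + 1, 2 * ‖V k - V (k + 1)‖ < (ν₂ - ν₁) * (R * √N) := by
    intro k hk
    -- The increment is $(1-\rho)X_k-\sqrt{1-\rho^2}\,\omega_{k+1}$, and both tensors are typical.
    have hd : InjBound (chain ρ ω k - chain ρ ω (k + 1)) ((1 - ρ) * C + √(1 - ρ ^ 2) * C) := by
      have h1 := (hX k hk.le).1.add_smul (hZ k hk.le).1 (1 - ρ) (-√(1 - ρ ^ 2))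
      rw [abs_of_pos (by linarith), abs_neg, abs_of_nonneg (Real.sqrt_nonneg _)] at h1
      convert h1 using 1
      rw [chain]
      module
    have h2 := hL _ _ _ (by
      have := Real.sqrt_nonneg (1 - ρ ^ 2)
      have : 0 < 1 - ρ := by linarith
      positivity) (hX k hk.le).1 hd
    calc 2 * ‖V k - V (k + 1)‖ ≤ 2 * (L * ((1 - ρ) * C + √(1 - ρ ^ 2) * C) * √N) := by gcongr
      _ = 2 * (L * ((1 - ρ) * C + √(1 - ρ ^ 2) * C)) * √N := by ring
      _ < (ν₂ - ν₁) * R * √N := by gcongr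
      _ = _ := by ring
  have hfar : |inner ℝ (V 0) (V (j + 1))| ≤ ε * N := by
    refine (hW j (by omega)).2 _ (hVc 0) _ (hVc (j + 1)) ?_ ?_
    · have h1 : Tensor.form (ω 0) (V 0) / N < m + θ + μ' := hen 0 (by omega)
      refine h1.le.trans ?_
      nlinarith
    · have h1 := hen (j + 1) le_rfl
      have hpos := one_sub_pow_pos hρ0.le hρ1 j
      rw [chain_eq hρ0.le hρ1, form_add_smul] at h1
      set t := √(1 - ρ ^ (2 * (j + 1)))
      have ht0 : 0 < t := Real.sqrt_pos.2 hpos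
      have ht1 : t ≤ 1 := Real.sqrt_le_one.2 (by linarith [pow_pos hρ0 (2 * (j + 1))])
      have hω0 : InjBound (ω 0) C := (hX 0 (by omega)).1
      have h2 := abs_form_le_of_injBound hω0 (V (j + 1))
      have h3 : (‖V (j + 1)‖ / √N) ^ (r + 1) ≤ 1 :=
        pow_le_one₀ (by positivity) ((div_le_one hsN).2 (norm_le_sqrt_of_mem_cube (hVc _)))
      have h4 : -(C * N) ≤ Tensor.form (ω 0) (V (j + 1)) := by
        have : C * N * (‖V (j + 1)‖ / √N) ^ (r + 1) ≤ C * N := mul_le_of_le_one_right (by positivity) h3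
        linarith [(abs_le.1 h2).1]
      have h5 : -C ≤ Tensor.form (ω 0) (V (j + 1)) / N := by
        rw [le_div_iff₀ hNr]; linarith
      set w := Tensor.form (freshPart ρ ω (j + 1)) (V (j + 1)) / N with hw
      have h6 : ρ ^ (j + 1) * (Tensor.form (ω 0) (V (j + 1)) / N) + t * w < m + θ + μ' := by
        rw [hw, mul_div, mul_div, ← add_div]; exact h1
      have h7 : ρ ^ (j + 1) * -C ≤ ρ ^ (j + 1) * (Tensor.form (ω 0) (V (j + 1)) / N) :=
        mul_le_mul_of_nonneg_left h5 (by positivity)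
      -- The errors are `θ` from the ground state, `μ' ≤ θ` from success, and `ρ ^ (j + 1) * C ≤ θ`
      -- from what is left of `ω 0`. As the bound is negative and `t ≤ 1`, it passes to `w`.
      have h8 : t * w ≤ m + 3 * θ := by linarith
      have h9 : w ≤ m + 3 * θ := by
        by_contra hcon
        nlinarith
      refine h9.trans ?_
      nlinarith
  rcases overlap_ge_of_small_steps hν₂.le (mul_pos hR hsN) hnorm hstep hgap with h | h
  · rw [mul_pow, Real.sq_sqrt hNr.le] at h
    have : ε * N < ν₂ * R ^ 2 * N := by gcongr
    linarith
  · linarith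

end PSpin

/-! ### Choice of parameters and conclusion. -/

namespace PSpin

lemma exists_correlation {L C η : ℝ} (hη : 0 < η) :
    ∃ ρ : ℝ, 0 < ρ ∧ ρ < 1 ∧ 2 * (L * ((1 - ρ) * C + √(1 - ρ ^ 2) * C)) < η := by
  have hc : Continuous fun ρ : ℝ => 2 * (L * ((1 - ρ) * C + √(1 - ρ ^ 2) * C)) := by fun_prop
  have h1 : ∀ᶠ ρ : ℝ in nhds 1, 2 * (L * ((1 - ρ) * C + √(1 - ρ ^ 2) * C)) < η := by
    refine hc.continuousAt.eventually_lt continuousAt_const ?_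
    simpa using hη
  have h2 : ∀ᶠ ρ : ℝ in nhdsWithin 1 (Set.Iio 1), 0 < ρ :=
    (lt_mem_nhds one_pos).filter_mono nhdsWithin_le_nhds
  obtain ⟨ρ, h⟩ := (((h1.filter_mono nhdsWithin_le_nhds).and h2).and
    self_mem_nhdsWithin).exists
  exact ⟨ρ, h.1.2, h.2, h.1.1⟩

lemma exists_pow_two_pow_mul_le {ρ C θ : ℝ} (h0 : 0 ≤ ρ) (h1 : ρ < 1) (hC : 0 < C) (hθ : 0 < θ) :
    ∃ m : ℕ, ρ ^ 2 ^ m * C ≤ θ := by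
  obtain ⟨n, hn⟩ := exists_pow_lt_of_lt_one (div_pos hθ hC) h1
  refine ⟨n, ?_⟩
  rw [← le_div_iff₀ hC]
  exact (pow_le_pow_of_le_one h0 h1.le n.lt_two_pow_self.le).trans hn.le

/-- If typical chains cannot succeed at every step, then success is exponentially unlikely. -/
lemma eventually_measure_le_of_chain {p : ℕ} (S G : ∀ N : ℕ, Set (Tensor p N))
    (H : ∀ N : ℕ, Set (Tensor p N × Tensor p N)) {ρ c : ℝ} (hρ0 : 0 ≤ ρ) (hρ1 : ρ < 1)
    (hc : 0 < c) (m : ℕ) (hS : ∀ N, MeasurableSet (S N))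
    (hG : ∀ᶠ N : ℕ in atTop, (gaussianTensor p N).real (G N)ᶜ ≤ 3 * Real.exp (-c * N))
    (hH : ∀ᶠ N : ℕ in atTop, (gaussianTensorPair p N).real (H N)ᶜ ≤ 2 * Real.exp (-c * N))
    (hfalse : ∀ᶠ N : ℕ in atTop, ∀ ω : ℕ → Tensor p N, (∀ k ≤ 2 ^ m, chain ρ ω k ∈ S N) →
      (∀ k ≤ 2 ^ m, chain ρ ω k ∈ G N) → (∀ k ≤ 2 ^ m, ω (k + 1) ∈ G N) →
      (∀ k ≤ 2 ^ m, (ω 0, freshPart ρ ω (k + 1)) ∈ H N) → False) :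
    ∀ᶠ N : ℕ in atTop,
      (gaussianTensor p N).real (S N) ≤ Real.exp (-(c / (2 * 2 ^ (m + 1))) * N) := by
  -- At each of the $2^m+1$ times the exceptional events cost $3+3+2=8$ times $e^{-cN}$, while the
  -- assumed success probability, raised to the power $2^{m+1}$, exceeds $e^{-cN/2}$.
  have hlim : ∀ᶠ N : ℕ in atTop, 8 * (2 ^ m + 1 : ℝ) < Real.exp (c / 2 * N) := by
    have : Tendsto (fun N : ℕ => Real.exp (c / 2 * N)) atTop atTop :=
      Real.tendsto_exp_atTop.comp
        ((tendsto_natCast_atTop_atTop (R := ℝ)).const_mul_atTop (by positivity))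
    exact this.eventually_gt_atTop _
  filter_upwards [hG, hH, hfalse, hlim] with N hG hH hfalse hlim
  by_contra hcon
  set v : ℝ≥0 := ((N : ℝ≥0) ^ (p - 1))⁻¹
  let P := noiseLaw (Fin p → Fin N) v
  have hlow := pow_measure_le_measure_chain v hρ0 hρ1 (hS N) m
  have hpow : Real.exp (-(c / 2) * N) ≤ (gaussianTensor p N).real (S N) ^ 2 ^ (m + 1) := by
    have h1 := pow_le_pow_left₀ (Real.exp_pos _).le (not_le.1 hcon).le (2 ^ (m + 1))
    rw [← Real.exp_nat_mul] at h1
    refine le_trans (le_of_eq ?_) h1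
    congr 1
    push_cast
    field_simp
  let B1 : ℕ → Set (ℕ → Tensor p N) := fun k => (fun ω => chain ρ ω k) ⁻¹' (G N)ᶜ
  let B2 : ℕ → Set (ℕ → Tensor p N) := fun k => (fun ω => ω (k + 1)) ⁻¹' (G N)ᶜ
  let B3 : ℕ → Set (ℕ → Tensor p N) := fun k =>
    (fun ω => (ω 0, freshPart ρ ω (k + 1))) ⁻¹' (H N)ᶜ
  have hB : ∀ k ∈ Finset.range (2 ^ m + 1), P.real (B1 k ∪ B2 k ∪ B3 k) ≤
      8 * Real.exp (-c * N) := by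
    intro k _
    have h1 : P.real (B1 k) ≤ _ :=
      (measureReal_preimage_le (measurePreserving_chain v hρ0 hρ1.le k) (G N)ᶜ).trans hG
    have h2 : P.real (B2 k) ≤ _ :=
      (measureReal_preimage_le (measurePreserving_noise v (k + 1)) (G N)ᶜ).trans hG
    have h3 : P.real (B3 k) ≤ _ :=
      (measureReal_preimage_le (measurePreserving_freshPart v hρ0 hρ1 k) (H N)ᶜ).trans hH
    have h4 := measureReal_union_le (μ := P) (B1 k ∪ B2 k) (B3 k)
    have h5 := measureReal_union_le (μ := P) (B1 k) (B2 k)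
    linarith
  have hsub : {ω : ℕ → Tensor p N | ∀ k ≤ 2 ^ m, chain ρ ω k ∈ S N} ⊆
      ⋃ k ∈ Finset.range (2 ^ m + 1), (B1 k ∪ B2 k ∪ B3 k) := by
    intro ω hω
    by_contra hno
    simp only [Set.mem_iUnion, Finset.mem_range, exists_prop, not_exists, not_and,
      Nat.lt_succ_iff, Set.mem_union, not_or, B1, B2, B3, Set.mem_preimage, Set.mem_compl_iff,
      not_not] at hno
    exact hfalse ω hω (fun k hk => (hno k hk).1.1) (fun k hk => (hno k hk).1.2)
      fun k hk => (hno k hk).2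
  have hup : P.real {ω : ℕ → Tensor p N | ∀ k ≤ 2 ^ m, chain ρ ω k ∈ S N} ≤
      (2 ^ m + 1) * (8 * Real.exp (-c * N)) := by
    calc _ ≤ _ := measureReal_mono hsub (measure_ne_top _ _)
      _ ≤ _ := measureReal_biUnion_finset_le _ _
      _ ≤ (Finset.range (2 ^ m + 1)).card • (8 * Real.exp (-c * N)) :=
        Finset.sum_le_card_nsmul _ _ _ hB
      _ = _ := by rw [Finset.card_range, nsmul_eq_mul]; push_cast; ring
  have h1 := hpow.trans (hlow.trans hup)
  have h2 : Real.exp (-(c / 2) * N) = Real.exp (c / 2 * N) * Real.exp (-c * N) := by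
    rw [← Real.exp_add]; congr 1; ring
  rw [h2] at h1
  have h3 := Real.exp_pos (-c * N)
  have := mul_lt_mul_of_pos_right hlim h3
  linarith

end PSpin

theorem mainTheorem5 (p : ℕ) (hp : 4 ≤ p) (hp_even : Even p) (hconj : PSpin.OGPConjecture p) :
    ∃ μbar : ℝ, 0 < μbar ∧ ∃ β₀ : ℝ, 0 < β₀ ∧
      ∀ M : ℝ, 0 < M → ∀ T : ℕ, 0 < T → ∀ β : ℝ, β₀ ≤ β →
      ∀ q : ℝ, 0 < q → ∀ a : ℕ → ℝ, (∃ C : ℝ, ∀ t, |a t| ≤ C) →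
      ∃ c : ℝ, 0 < c ∧ ∀ᶠ N : ℕ in Filter.atTop,
        ∀ s κ : ℝ, 0 ≤ s → 0 ≤ κ →
          1 - Real.exp (-c * N) ≤
            (PSpin.gaussianTensor p N).real
              {A | sInf (PSpin.tapFreeEnergy β s κ A '' PSpin.cube N) / (β * N) + μbar ≤
                PSpin.tapFreeEnergy β s κ A (PSpin.tapOutput A β M q a T) / (β * N)} := by
  open PSpin in
  obtain ⟨r, rfl⟩ : ∃ r, p = r + 1 := ⟨p - 1, by omega⟩
  have hr : 0 < r := by omega
  obtain ⟨⟨μ, ν₁, ν₂, hμ, hν₁, hν, hν₂, c₁, hc₁, hgap⟩, hfar⟩ := hconj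
  obtain ⟨C, hC, hinj⟩ := exists_injBound (r + 1) (by omega)
  obtain ⟨c₀, hc₀, hmean⟩ := exists_integral_groundState_le (p := r + 1) (by omega)
  obtain ⟨R, hR, hRC⟩ : ∃ R : ℝ, 0 < R ∧ C * R ^ (r + 1) ≤ c₀ / 2 := by
    refine ⟨min 1 (c₀ / (2 * C)), by positivity, ?_⟩
    have h1 : min 1 (c₀ / (2 * C)) ^ (r + 1) ≤ c₀ / (2 * C) :=
      (pow_le_of_le_one (by positivity) (min_le_left _ _) (by omega)).trans (min_le_right _ _)
    calc _ ≤ C * (c₀ / (2 * C)) := by gcongr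
      _ = c₀ / 2 := by field_simp
  have hν₂0 : 0 < ν₂ := hν₁.trans hν
  -- Half of the overlap that the gap enforces on vectors of norm at least $R\sqrt N$.
  set ε := ν₂ * R ^ 2 / 2 with hε
  have hε0 : 0 < ε := by positivity
  obtain ⟨δ, hδ, c₂, hc₂, hfar⟩ := hfar ε hε0
  -- Small enough that an energy `3θ` above the mean is negative and still below `1 - δ` times the
  -- mean.
  set θ := min δ 1 * c₀ / 4 with hθ
  have hθ0 : 0 < θ := by positivity
  have hθ1 : 4 * θ ≤ c₀ := by
    have : min δ 1 * c₀ ≤ 1 * c₀ := by gcongr; exact min_le_right _ _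
    linarith
  have hθδ : 4 * θ ≤ δ * c₀ := by
    have : min δ 1 * c₀ ≤ δ * c₀ := by gcongr; exact min_le_left _ _
    linarith
  set μ' := min (μ / 2) θ with hμ'
  have hμ'0 : 0 < μ' := by positivity
  -- The gap `μ'` is fixed before the iteration; only `ρ`, `m` and the final rate depend on it,
  -- through `L`. The threshold 1 merely ensures `β > 0`.
  refine ⟨μ', hμ'0, 1, one_pos, fun M hM T _ β hβ q hq a _ => ?_⟩
  have hβ0 : 0 < β := one_pos.trans_le hβ
  obtain ⟨L, _, hL⟩ := exists_norm_tapOutput_sub_le hr β hM hq hC.le a T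
  obtain ⟨ρ, hρ0, hρ1, hρL⟩ :=
    exists_correlation (L := L) (C := C) (mul_pos (sub_pos.2 hν) hR)
  obtain ⟨m, hρm⟩ := exists_pow_two_pow_mul_le hρ0.le hρ1 hC hθ0
  set c := min (min c₁ c₂) (min 1 (θ ^ 2 / 4)) with hc
  have hc0 : 0 < c := by positivity
  have hcc₁ : c ≤ c₁ := (min_le_left _ _).trans (min_le_left _ _)
  have hcc₂ : c ≤ c₂ := (min_le_left _ _).trans (min_le_right _ _)
  have hcc₃ : c ≤ 1 := (min_le_right _ _).trans (min_le_left _ _)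
  have hcc₄ : c ≤ θ ^ 2 / 4 := (min_le_right _ _).trans (min_le_right _ _)
  -- With `b = μ / 4`, passing from corners to the cube costs `μ / 2`, and `μ' ≤ μ / 2` is left for
  -- success.
  have hG := eventually_measure_compl_typicalSet_le (by omega) hinj
    (by positivity : 0 < μ / 4) hθ0 hcc₃ hcc₄
  have hH : ∀ᶠ N : ℕ in Filter.atTop, (gaussianTensorPair (r + 1) N).real
      (gapSet (r + 1) N μ ν₁ ν₂ ε δ)ᶜ ≤ 2 * Real.exp (-c * N) := by
    filter_upwards [hgap, hfar] with N h1 h2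
    have hN0 : (0 : ℝ) ≤ N := by positivity
    have e1 : Real.exp (-c₁ * N) ≤ Real.exp (-c * N) := Real.exp_le_exp.2 (by nlinarith)
    have e2 : Real.exp (-c₂ * N) ≤ Real.exp (-c * N) := Real.exp_le_exp.2 (by nlinarith)
    rw [gapSet, Set.ofPred_and, Set.compl_inter]
    refine (MeasureTheory.measureReal_union_le _ _).trans ?_
    exact (add_le_add (h1.trans e1) (h2.trans e2)).trans_eq (by ring)
  have hS := eventually_measure_le_of_chain (fun N => successSet (r + 1) N β M q a T μ')
    (fun N => typicalSet (r + 1) N C (μ / 4) θ) (fun N => gapSet (r + 1) N μ ν₁ ν₂ ε δ)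
    hρ0.le hρ1 hc0 m (fun N => measurableSet_successSet β M q a T μ') hG hH (by
      filter_upwards [Filter.eventually_ge_atTop 2] with N hN ω h1 h2 h3 h4
      obtain ⟨j, hj⟩ : ∃ j, 2 ^ m = j + 1 := ⟨2 ^ m - 1, by have := Nat.two_pow_pos m; omega⟩
      rw [hj] at h1 h2 h3 h4 hρm
      refine false_of_chain_success (by omega) hC ?_ hν hν₁ hν₂ hc₀ hθ0 (min_le_right _ _)
        hR hRC ?_ (hmean N hN) hθ1 hθδ (hL N (by omega)) hρ0 hρ1 hρL hρm ω h1 h2 h3 h4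
      · linarith [min_le_left (μ / 2) θ]
      · rw [hε]; exact half_lt_self (by positivity))
  refine ⟨c / (2 * 2 ^ (m + 1)), by positivity, ?_⟩
  filter_upwards [hS, Filter.eventually_gt_atTop 0] with N hS hN s κ hs hκ
  have hsub : (successSet (r + 1) N β M q a T μ')ᶜ ⊆
      {A | sInf (tapFreeEnergy β s κ A '' cube N) / (β * N) + μ' ≤
        tapFreeEnergy β s κ A (tapOutput A β M q a T) / (β * N)} := fun A hA =>
    sInf_tapFreeEnergy_add_le hN hβ0 hs hκ A (trunc_mem_cube _) (not_lt.1 hA)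
  refine le_trans ?_ (MeasureTheory.measureReal_mono hsub (MeasureTheory.measure_ne_top _ _))
  rw [MeasureTheory.probReal_compl_eq_one_sub (measurableSet_successSet β M q a T μ')]
  linarith
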